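/- Let $X\in\mathbb{R}^{n\times p}$, $\lambda\ge 0$, $\sigma>0$. For $z\in\mathbb{R}^n$ let the lasso estimate at $z$ be the unique minimizer over $b\in\mathbb{R}^p$ of $\tfrac12\|z-Xb\|_2^2+\lambda\|b\|_1$, and write $S(z)=M$ if this estimate exists and has support exactly $M\subseteq\{1,\dots,p\}$. Fix $M$ and let $X_M$ be the submatrix of $X$ of the columns in $M$. For $\beta\in\mathbb{R}^{M}$ let $P_\beta$ be the law $N(X_M\beta,\sigma^2 I_n)$ of a response $y^*$, assume that $P_\beta(S(y^*)=M)>0$ for every $\beta$, and write $\mathrm{E}_\beta(\,\cdot\mid M)$ for expectation under $P_\beta$ conditioned on $S(y^*)=M$. Let $\eta=(X_M^TX_M)^{-1}X_M^Ty^*$, so that unconditionally $\eta\sim N(\beta,\sigma^2(X_M^TX_M)^{-1})$. (1) Suppose that for every sign vector $s\in\{-1,1\}^{M}$ and every $\beta$, the event that $S(y^*)=M$ and that the active lasso coefficients have signs $s$ has positive probability under $P_\beta$. Then there is a constant $A$ such that for all $\beta\in\mathbb{R}^{M}$ the expectations below exist and $$\mathrm{E}_\beta\left(\left\|(X_M^TX_M)\eta-X_M^T\mathrm{E}_\beta(y^*\mid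 M)\right\|_2^2\,\middle|\,M\right)\le A .$$ (2) Let $y\in\mathbb{R}^n$ be an observation with $S(y)=M$, and let $\gamma_i\ge 0$ $(i\ge1)$ satisfy $\sum_i\gamma_i=\infty$ and $\sum_i\gamma_i^2<\infty$. Let $(\mathcal F_i)_{i\ge0}$ be a filtration on a probability space, let $\hat\beta^0\in\mathbb{R}^{M}$ be deterministic, and let $$\hat\beta^{i}=\hat\beta^{i-1}+\gamma_i\left(X_M^Ty-(X_M^TX_M)\eta^i\right),\qquad i\ge1,$$ where $\eta^i$ is $\mathcal F_i$-measurable and its conditional law given $\mathcal F_{i-1}$ is the law of $\eta$ under $P_{\hat\beta^{i-1}}(\,\cdot\mid M)$. Then almost surely the sequence $(\hat\beta^i)$ converges, and its limit $\hat\beta^\infty$ satisfies $$\psi(\hat\beta^\infty):=X_M^Ty-\mathrm{E}_{\hat\beta^\infty}(X_M^Ty^*\mid M)=0 .$$ -/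

import Mathlib

open MeasureTheory ProbabilityTheory Filter Topology

noncomputable section

namespace PostSelLasso

variable {n p : ℕ}

/-- The lasso objective `½‖y - X b‖² + lam * ‖b‖₁`. -/
def lassoObjective (X : Matrix (Fin n) (Fin p) ℝ) (lam : ℝ) (y : EuclideanSpace ℝ (Fin n))
    (b : EuclideanSpace ℝ (Fin p)) : ℝ :=
  (1 / 2) * ‖y - Matrix.toEuclideanLin X b‖ ^ 2 + lam * ∑ j, |b j|

/-- `b` is the lasso estimate at `y`: the (unique) minimizer of the lasso objective. -/
def IsLassoEstimate (X : Matrix (Fin n) (Fin p) ℝ) (lam : ℝ) (y : EuclideanSpace ℝ (Fin n))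
    (b : EuclideanSpace ℝ (Fin p)) : Prop :=
  ∀ b', b' ≠ b → lassoObjective X lam y b < lassoObjective X lam y b'

/-- The event `S(y) = M`: the lasso estimate at `y` has support exactly `M`. -/
def selectionEvent (X : Matrix (Fin n) (Fin p) ℝ) (lam : ℝ) (M : Finset (Fin p)) :
    Set (EuclideanSpace ℝ (Fin n)) :=
  {y | ∃ b, IsLassoEstimate X lam y b ∧ ∀ j, j ∈ M ↔ b j ≠ 0}

/-- The event that `S(y) = M` and that the active lasso coefficients have the signs `s`. -/
def signedSelectionEvent (X : Matrix (Fin n) (Fin p) ℝ) (lam : ℝ) (M : Finset (Fin p))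
    (s : M → ℤˣ) : Set (EuclideanSpace ℝ (Fin n)) :=
  {y | ∃ b, IsLassoEstimate X lam y b ∧ (∀ j, j ∈ M ↔ b j ≠ 0) ∧
    ∀ j : M, 0 < ((s j : ℤ) : ℝ) * b j}

/-- `X_M`, the columns of `X` indexed by `M`. -/
def activeCols (X : Matrix (Fin n) (Fin p) ℝ) (M : Finset (Fin p)) : Matrix (Fin n) M ℝ :=
  X.submatrix id Subtype.val

/-- The Gram matrix `X_Mᵀ X_M`. -/
def gram (X : Matrix (Fin n) (Fin p) ℝ) (M : Finset (Fin p)) : Matrix M M ℝ :=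
  (activeCols X M).transpose * activeCols X M

/-- The sufficient statistic `X_Mᵀ z`. -/
def suffStat (X : Matrix (Fin n) (Fin p) ℝ) (M : Finset (Fin p))
    (z : EuclideanSpace ℝ (Fin n)) : EuclideanSpace ℝ M :=
  Matrix.toEuclideanLin (activeCols X M).transpose z

/-- The least squares estimator `η = (X_Mᵀ X_M)⁻¹ X_Mᵀ z`. -/
def leastSquares (X : Matrix (Fin n) (Fin p) ℝ) (M : Finset (Fin p))
    (z : EuclideanSpace ℝ (Fin n)) : EuclideanSpace ℝ M :=
  Matrix.toEuclideanLin (gram X M)⁻¹ (suffStat X M z)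

/-- The unconditional law `N(X_M β, σ² I)` of the response. -/
def responseLaw (X : Matrix (Fin n) (Fin p) ℝ) (M : Finset (Fin p)) (σ : ℝ)
    (β : EuclideanSpace ℝ M) : Measure (EuclideanSpace ℝ (Fin n)) :=
  multivariateGaussian (Matrix.toEuclideanLin (activeCols X M) β)
    (σ ^ 2 • (1 : Matrix (Fin n) (Fin n) ℝ))

/-- The law `P_β(· | M)` of the response, conditional on the lasso selecting `M`. -/
def condResponseLaw (X : Matrix (Fin n) (Fin p) ℝ) (lam : ℝ) (M : Finset (Fin p)) (σ : ℝ)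
    (β : EuclideanSpace ℝ M) : Measure (EuclideanSpace ℝ (Fin n)) :=
  cond (responseLaw X M σ β) (selectionEvent X lam M)

/-- The post-selection law `f_β(η | M)` of the least squares estimator. -/
def postSelectionLaw (X : Matrix (Fin n) (Fin p) ℝ) (lam : ℝ) (M : Finset (Fin p)) (σ : ℝ)
    (β : EuclideanSpace ℝ M) : Measure (EuclideanSpace ℝ M) :=
  (condResponseLaw X lam M σ β).map (leastSquares X M)

/-- `ψ(β) = X_Mᵀ y - E_β(X_Mᵀ y | M)`. -/
def score (X : Matrix (Fin n) (Fin p) ℝ) (lam : ℝ) (M : Finset (Fin p)) (σ : ℝ)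
    (y : EuclideanSpace ℝ (Fin n)) (β : EuclideanSpace ℝ M) : EuclideanSpace ℝ M :=
  suffStat X M y - ∫ z, suffStat X M z ∂(condResponseLaw X lam M σ β)

/-- `(b i)` are the iterates of the stochastic ascent algorithm with step sizes `γ 1, γ 2, …`,
started at `b₀`. Given the past `ℱ i`, the sample `η (i + 1)` is drawn from the post-selection
law of the least squares estimator at the current parameter `b i`. -/
structure IsStochasticAscent {Ω : Type*} {mΩ : MeasurableSpace Ω} (P : Measure Ω)
    (ℱ : Filtration ℕ mΩ) (X : Matrix (Fin n) (Fin p) ℝ) (lam : ℝ) (M : Finset (Fin p)) (σ : ℝ)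
    (y : EuclideanSpace ℝ (Fin n)) (γ : ℕ → ℝ) (b₀ : EuclideanSpace ℝ M)
    (b η : ℕ → Ω → EuclideanSpace ℝ M) : Prop where
  init : ∀ ω, b 0 ω = b₀
  step : ∀ i ω, b (i + 1) ω =
    b i ω + γ (i + 1) • (suffStat X M y - Matrix.toEuclideanLin (gram X M) (η (i + 1) ω))
  measurable_sample : ∀ i, Measurable[ℱ (i + 1)] (η (i + 1))
  sample_law : ∀ i, ∀ B : Set (EuclideanSpace ℝ M), MeasurableSet B →
    P⟦η (i + 1) ⁻¹' B | ℱ i⟧ =ᵐ[P] fun ω => (postSelectionLaw X lam M σ (b i ω)).real B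

end PostSelLasso

end

/-! Write T(z) = X_Mᵀz. By Cameron–Martin, P_β is P_0 tilted by exp⟨β, T/σ²⟩, and conditioning on S
= M commutes with tilting (`cond_tilted`). So the conditional laws of σ⁻²(T − X_Mᵀy) form an
exponential family in β whose mean is −σ⁻²ψ(β): the zeros of ψ are the critical points of a convex
log-partition function, and the algorithm is stochastic gradient descent on it.

The geometric input is `signedSelectionEvent_add`. Adding X_M v to the response, with v weakly
agreeing in sign with the active coefficients, shifts the estimate by v and keeps the residual, so
the signed event is stable under such moves.

For (1), passing from P_0 to P_β cannot decrease the probability of the sign pattern of β. Hence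
P_β(S = M) is at least the smallest of finitely many positive numbers, and the conditional variance
is at most an unconditional one, free of β, divided by this bound.

For (2), stability and the symmetry of P_0 under z ↦ −z make T unbounded in every direction on the
selection event (`responseLaw_inter_selectionEvent_pos`). The partition function is then coercive,
its minimiser β₀ solves ψ = 0, and the mean map points away from β₀. Second moments grow at most
quadratically even without a uniform variance bound, so `ae_tendsto_robbinsMonro` applies with
Lyapunov function 1 + ‖β − β₀‖². -/

noncomputable section

namespace PostSelLasso

set_option linter.unusedSectionVars false

/-! ### Integrability and continuity under a square-exponential moment. -/

section ExponentialFamily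

variable {E : Type*} [NormedAddCommGroup E] [InnerProductSpace ℝ E]

/-- One extra `r` in the exponent pays for the polynomial factor; completing the square handles `(R
+ 1) * r`. -/
lemma exp_mul_one_add_sq_le {a : ℝ} (ha : 0 < a) (R r : ℝ) (hr : 0 ≤ r) :
    Real.exp (R * r) * (1 + r ^ 2)
      ≤ 2 * Real.exp ((R + 1) ^ 2 / (4 * a)) * Real.exp (a * r ^ 2) := by
  have h1 : 1 + r ^ 2 ≤ 2 * Real.exp r := by
    have := Real.quadratic_le_exp_of_nonneg hr
    nlinarith
  have h2 : R * r + r ≤ (R + 1) ^ 2 / (4 * a) + a * r ^ 2 := by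
    have h4 : (R + 1) ^ 2 / (4 * a) + a * r ^ 2 - (R * r + r)
        = ((R + 1) - 2 * a * r) ^ 2 / (4 * a) := by field_simp; ring
    have h5 : 0 ≤ ((R + 1) - 2 * a * r) ^ 2 / (4 * a) := by positivity
    linarith
  calc Real.exp (R * r) * (1 + r ^ 2) ≤ Real.exp (R * r) * (2 * Real.exp r) := by gcongr
    _ = 2 * Real.exp (R * r + r) := by rw [Real.exp_add]; ring
    _ ≤ 2 * Real.exp ((R + 1) ^ 2 / (4 * a) + a * r ^ 2) := by gcongr
    _ = _ := by rw [Real.exp_add]; ring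

variable [MeasurableSpace E] [BorelSpace E] [SecondCountableTopology E]
  {ρ : Measure E} {a : ℝ}

lemma integrable_exp_mul_norm (ha : 0 < a)
    (hρ : Integrable (fun x => Real.exp (a * ‖x‖ ^ 2)) ρ) (R : ℝ) :
    Integrable (fun x => Real.exp (R * ‖x‖) * (1 + ‖x‖ ^ 2)) ρ := by
  refine (hρ.const_mul (2 * Real.exp ((R + 1) ^ 2 / (4 * a)))).mono' ?_ (ae_of_all _ fun x => ?_)
  · exact Continuous.aestronglyMeasurable (by fun_prop)
  · rw [Real.norm_of_nonneg (by positivity)]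
    exact exp_mul_one_add_sq_le ha R _ (norm_nonneg x)

lemma integrable_of_norm_le_exp (ha : 0 < a)
    (hρ : Integrable (fun x => Real.exp (a * ‖x‖ ^ 2)) ρ) {F : Type*} [NormedAddCommGroup F]
    {g : E → F} (hg : AEStronglyMeasurable g ρ) (R C : ℝ)
    (h : ∀ x, ‖g x‖ ≤ C * (Real.exp (R * ‖x‖) * (1 + ‖x‖ ^ 2))) : Integrable g ρ :=
  ((integrable_exp_mul_norm ha hρ R).const_mul C).mono' hg (ae_of_all _ h)

lemma exp_inner_le (β x : E) : Real.exp (inner ℝ β x) ≤ Real.exp (‖β‖ * ‖x‖) :=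
  Real.exp_le_exp.2 (real_inner_le_norm β x)

lemma integrable_exp_inner (ha : 0 < a)
    (hρ : Integrable (fun x => Real.exp (a * ‖x‖ ^ 2)) ρ) (β : E) :
    Integrable (fun x => Real.exp (inner ℝ β x)) ρ := by
  refine integrable_of_norm_le_exp ha hρ (Continuous.aestronglyMeasurable (by fun_prop)) ‖β‖ 1
    fun x => ?_
  rw [Real.norm_of_nonneg (by positivity), one_mul]
  refine (exp_inner_le β x).trans (le_mul_of_one_le_right (by positivity) ?_)
  nlinarith [sq_nonneg ‖x‖]

lemma integrable_exp_inner_smul (ha : 0 < a)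
    (hρ : Integrable (fun x => Real.exp (a * ‖x‖ ^ 2)) ρ) (β : E) :
    Integrable (fun x => Real.exp (inner ℝ β x) • x) ρ := by
  refine integrable_of_norm_le_exp ha hρ
    (Continuous.aestronglyMeasurable (by fun_prop)) ‖β‖ 1 fun x => ?_
  rw [norm_smul, Real.norm_of_nonneg (by positivity), one_mul]
  gcongr
  · exact real_inner_le_norm β x
  · nlinarith [sq_nonneg (‖x‖ - 1)]

lemma integrable_exp_inner_mul_inner (ha : 0 < a)
    (hρ : Integrable (fun x => Real.exp (a * ‖x‖ ^ 2)) ρ) (β w : E) :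
    Integrable (fun x => Real.exp (inner ℝ β x) * inner ℝ w x) ρ := by
  have := (integrable_exp_inner_smul ha hρ β).const_inner (𝕜 := ℝ) w
  simpa [inner_smul_right] using this

/-- Near `β₀` one has `‖β‖ < ‖β₀‖ + 1`, which turns the bound into a fixed integrable one. The
factor `C + ‖β‖` leaves room for integrands such as `exp ⟨β, x⟩ * ⟨β - β₀, x⟩`. -/
lemma continuous_integral_of_norm_le_exp (ha : 0 < a)
    (hρ : Integrable (fun x => Real.exp (a * ‖x‖ ^ 2)) ρ) {g : E → E → ℝ}
    (hm : ∀ β, Continuous (g β)) (hc : ∀ x, Continuous fun β => g β x) (C : ℝ)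
    (hb : ∀ β x, |g β x| ≤ (C + ‖β‖) * (Real.exp (‖β‖ * ‖x‖) * (1 + ‖x‖ ^ 2))) :
    Continuous fun β => ∫ x, g β x ∂ρ := by
  rw [continuous_iff_continuousAt]
  intro β₀
  refine continuousAt_of_dominated
    (bound := fun x => (|C| + (‖β₀‖ + 1)) * (Real.exp ((‖β₀‖ + 1) * ‖x‖) * (1 + ‖x‖ ^ 2)))
    (Eventually.of_forall fun β => (hm β).aestronglyMeasurable) ?_
    ((integrable_exp_mul_norm ha hρ _).const_mul _)
    (ae_of_all _ fun x => (hc x).continuousAt)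
  have : ∀ᶠ β in 𝓝 β₀, ‖β‖ < ‖β₀‖ + 1 :=
    continuous_norm.continuousAt.eventually_lt_const (by simp)
  filter_upwards [this] with β hβ
  refine ae_of_all _ fun x => (hb β x).trans ?_
  gcongr
  exact le_abs_self C

end ExponentialFamily

/-! ### Exponential families: minimiser of the partition function, monotone mean, moment growth. -/

section ExponentialFamily

variable {E : Type*} [NormedAddCommGroup E] [InnerProductSpace ℝ E] [FiniteDimensional ℝ E]
  [MeasurableSpace E] [BorelSpace E] {ρ : Measure E} [IsProbabilityMeasure ρ] {a : ℝ}

lemma continuous_integral_exp_inner (ha : 0 < a)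
    (hρ : Integrable (fun x => Real.exp (a * ‖x‖ ^ 2)) ρ) :
    Continuous fun β : E => ∫ x, Real.exp (inner ℝ β x) ∂ρ := by
  refine continuous_integral_of_norm_le_exp ha hρ (fun β => by fun_prop) (fun x => by fun_prop) 1
    fun β x => ?_
  rw [abs_of_pos (Real.exp_pos _)]
  have h1 := exp_inner_le β x
  have h2 : 1 ≤ (1 + ‖β‖) := by linarith [norm_nonneg β]
  have h3 : 1 ≤ 1 + ‖x‖ ^ 2 := by nlinarith [sq_nonneg ‖x‖]
  calc Real.exp (inner ℝ β x) ≤ 1 * (Real.exp (‖β‖ * ‖x‖) * 1) := by simpa using h1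
    _ ≤ _ := by gcongr

/-- The exponential dominates the positive part, and the integral of the truncated positive part of
`⟨u, x⟩` is continuous and positive on the compact unit sphere. Truncating at 1 keeps that integrand
bounded. The linear growth gives coercivity. -/
lemma exists_mul_norm_le_integral_exp_inner (ha : 0 < a)
    (hρ : Integrable (fun x => Real.exp (a * ‖x‖ ^ 2)) ρ)
    (hs : ∀ u : E, u ≠ 0 → 0 < ρ {x | 0 < inner ℝ u x}) :
    ∃ c > 0, ∀ β : E, c * ‖β‖ ≤ ∫ x, Real.exp (inner ℝ β x) ∂ρ := by
  set g : E → ℝ := fun u => ∫ x, min 1 (max 0 (inner ℝ u x)) ∂ρ with hg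
  have hle : ∀ u x : E, |min 1 (max 0 (inner ℝ u x))| ≤ 1 := fun u x => by
    rw [abs_of_nonneg (by positivity)]; exact min_le_left _ _
  have hint : ∀ u : E, Integrable (fun x => min 1 (max 0 (inner ℝ u x))) ρ := fun u =>
    (integrable_const (1 : ℝ)).mono' (Continuous.aestronglyMeasurable (by fun_prop))
      (ae_of_all _ fun x => hle u x)
  have hcont : Continuous g := by
    refine continuous_integral_of_norm_le_exp ha hρ (fun β => by fun_prop)
      (fun x => by fun_prop) 1 fun β x => (hle β x).trans ?_
    have h1 : 1 ≤ Real.exp (‖β‖ * ‖x‖) := Real.one_le_exp (by positivity)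
    have h2 : 1 ≤ (1 + ‖β‖) := by linarith [norm_nonneg β]
    have h3 : 1 ≤ 1 + ‖x‖ ^ 2 := by nlinarith [sq_nonneg ‖x‖]
    calc (1 : ℝ) = 1 * (1 * 1) := by norm_num
      _ ≤ _ := by gcongr
  have hpos : ∀ u ∈ Metric.sphere (0 : E) 1, 0 < g u := by
    intro u hu
    have hu0 : u ≠ 0 := by rintro rfl; simp at hu
    rw [hg]
    refine (integral_pos_iff_support_of_nonneg (fun x => by positivity) (hint u)).2
      ((hs u hu0).trans_le (measure_mono fun x hx => ?_))
    have hx' : 0 < inner ℝ u x := hx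
    have : 0 < min 1 (max 0 (inner ℝ u x)) := lt_min one_pos (lt_max_of_lt_right hx')
    exact this.ne'
  obtain ⟨c, hc, hcle⟩ := (isCompact_sphere (0 : E) 1).exists_forall_le' hcont.continuousOn hpos
  refine ⟨c, hc, fun β => ?_⟩
  rcases eq_or_ne β 0 with rfl | hβ
  · simp
  have hn : 0 < ‖β‖ := norm_pos_iff.2 hβ
  have hu := hcle (‖β‖⁻¹ • β) (by simp [norm_smul, hn.ne'])
  calc c * ‖β‖ ≤ g (‖β‖⁻¹ • β) * ‖β‖ := by gcongr
    _ = ∫ x, min 1 (max 0 (inner ℝ (‖β‖⁻¹ • β) x)) * ‖β‖ ∂ρ := by rw [integral_mul_const]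
    _ ≤ _ := by
      refine integral_mono ((hint _).mul_const _) (integrable_exp_inner ha hρ β) fun x => ?_
      have h1 : inner ℝ (‖β‖⁻¹ • β) x * ‖β‖ = inner ℝ β x := by
        rw [real_inner_smul_left]; field_simp
      calc min 1 (max 0 (inner ℝ (‖β‖⁻¹ • β) x)) * ‖β‖
          ≤ max 0 (inner ℝ (‖β‖⁻¹ • β) x) * ‖β‖ := by gcongr; exact min_le_right _ _
        _ = max 0 (inner ℝ β x) := by rw [max_mul_of_nonneg _ _ hn.le, h1, zero_mul]
        _ ≤ Real.exp (inner ℝ β x) := max_le (by positivity)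
            (by linarith [Real.add_one_le_exp (inner ℝ β x)])

lemma integral_inner_tilted (β w : E) :
    ∫ x, inner ℝ w x ∂(ρ.tilted (inner ℝ β))
      = (∫ x, Real.exp (inner ℝ β x) * inner ℝ w x ∂ρ) / ∫ x, Real.exp (inner ℝ β x) ∂ρ := by
  rw [integral_tilted, ← integral_div]
  congr with x
  rw [smul_eq_mul]; ring

/-- In an exponential family whose base measure is not supported in a half-space bounded by a
hyperplane through the origin, some parameter gives mean zero. -/
lemma exists_tilted_mean_zero (ha : 0 < a)
    (hρ : Integrable (fun x => Real.exp (a * ‖x‖ ^ 2)) ρ)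
    (hs : ∀ u : E, u ≠ 0 → 0 < ρ {x | 0 < inner ℝ u x}) :
    ∃ β : E, (∀ β', ∫ x, Real.exp (inner ℝ β x) ∂ρ ≤ ∫ x, Real.exp (inner ℝ β' x) ∂ρ) ∧
      ∀ w, ∫ x, inner ℝ w x ∂(ρ.tilted (inner ℝ β)) = 0 := by
  obtain ⟨c, hc, hle⟩ := exists_mul_norm_le_integral_exp_inner ha hρ hs
  obtain ⟨β, hβ⟩ := (continuous_integral_exp_inner ha hρ).exists_forall_le
    (tendsto_atTop_mono hle ((tendsto_norm_cocompact_atTop (E := E)).const_mul_atTop hc))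
  refine ⟨β, hβ, fun w => ?_⟩
  have hZ : 0 < ∫ x, Real.exp (inner ℝ β x) ∂ρ := integral_exp_pos (integrable_exp_inner ha hρ β)
  -- Along `β + t • w` the normalised partition function is the moment generating function of `⟨w,
  -- x⟩` under the tilt at `β`. Minimality at `t = 0` kills its derivative there, which is the mean.
  have hmgf : ∀ t, mgf (inner ℝ w) (ρ.tilted (inner ℝ β)) t
      = (∫ x, Real.exp (inner ℝ (β + t • w) x) ∂ρ) / ∫ x, Real.exp (inner ℝ β x) ∂ρ := by
    intro t
    rw [mgf, integral_exp_tilted]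
    congr 2 with x
    simp [inner_add_left, real_inner_smul_left]
  have hset : integrableExpSet (inner ℝ w) (ρ.tilted (inner ℝ β)) = Set.univ := by
    refine Set.eq_univ_of_forall fun t => ?_
    refine (integrable_tilted_iff (integrable_exp_inner ha hρ β) _).2 ?_
    refine (integrable_exp_inner ha hρ (β + t • w)).congr (ae_of_all _ fun x => ?_)
    simp [inner_add_left, real_inner_smul_left, Real.exp_add]
  have hmin : IsLocalMin (mgf (inner ℝ w) (ρ.tilted (inner ℝ β))) 0 := by
    refine Eventually.of_forall fun t => ?_
    rw [hmgf, hmgf]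
    refine div_le_div_of_nonneg_right ?_ hZ.le
    simpa using hβ (β + t • w)
  rw [← deriv_mgf_zero (by simp [hset])]
  exact hmin.deriv_eq_zero

/-- Strict monotonicity of the mean map of an exponential family at a parameter with mean zero. -/
lemma integral_inner_sub_tilted_pos (ha : 0 < a)
    (hρ : Integrable (fun x => Real.exp (a * ‖x‖ ^ 2)) ρ)
    (hs : ∀ u : E, u ≠ 0 → 0 < ρ {x | 0 < inner ℝ u x}) {β₀ β : E}
    (h0 : ∀ w, ∫ x, inner ℝ w x ∂(ρ.tilted (inner ℝ β₀)) = 0) (hne : β ≠ β₀) :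
    0 < ∫ x, inner ℝ (β - β₀) x ∂(ρ.tilted (inner ℝ β)) := by
  have hZ : ∀ β : E, 0 < ∫ x, Real.exp (inner ℝ β x) ∂ρ := fun β =>
    integral_exp_pos (integrable_exp_inner ha hρ β)
  set w := β - β₀ with hw
  have h0' : ∫ x, Real.exp (inner ℝ β₀ x) * inner ℝ w x ∂ρ = 0 := by
    have := h0 w
    rw [integral_inner_tilted] at this
    exact (div_eq_zero_iff.1 this).resolve_right (hZ β₀).ne'
  rw [integral_inner_tilted]
  refine div_pos ?_ (hZ β)
  have hI := (integrable_exp_inner_mul_inner ha hρ β w).sub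
    (integrable_exp_inner_mul_inner ha hρ β₀ w)
  have hsub := integral_sub (integrable_exp_inner_mul_inner ha hρ β w)
    (integrable_exp_inner_mul_inner ha hρ β₀ w)
  rw [h0', sub_zero] at hsub
  rw [← hsub]
  -- Subtracting the vanishing mean at `β₀` leaves a factor `(exp s - 1) * s` with `s = ⟨w, x⟩`:
  -- nonnegative everywhere, and positive on the half-space charged by `hs`.
  have key : ∀ x : E, Real.exp (inner ℝ β x) * inner ℝ w x - Real.exp (inner ℝ β₀ x) * inner ℝ w x
      = Real.exp (inner ℝ β₀ x) * ((Real.exp (inner ℝ w x) - 1) * inner ℝ w x) := by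
    intro x
    have : β = β₀ + w := by simp [hw]
    rw [this, inner_add_left, Real.exp_add]; ring
  refine (integral_pos_iff_support_of_nonneg (fun x => ?_) hI).2
    ((hs w (sub_ne_zero.2 hne)).trans_le (measure_mono fun x hx => ?_))
  · simp only [Pi.zero_apply, Pi.sub_apply, key]
    refine mul_nonneg (Real.exp_pos _).le ?_
    rcases le_total 0 (inner ℝ w x) with h | h
    · exact mul_nonneg (by linarith [Real.one_le_exp h]) h
    · exact mul_nonneg_of_nonpos_of_nonpos (by linarith [Real.exp_le_one_iff.2 h]) h
  · have hx' : 0 < inner ℝ w x := hx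
    simp only [Function.mem_support, Pi.sub_apply, key]
    have := Real.one_lt_exp_iff.2 hx'
    have h3 : 0 < Real.exp (inner ℝ w x) - 1 := by linarith
    positivity

lemma continuous_integral_inner_sub_tilted (ha : 0 < a)
    (hρ : Integrable (fun x => Real.exp (a * ‖x‖ ^ 2)) ρ) (β₀ : E) :
    Continuous fun β => ∫ x, inner ℝ (β - β₀) x ∂(ρ.tilted (inner ℝ β)) := by
  simp_rw [integral_inner_tilted]
  refine Continuous.div ?_ (continuous_integral_exp_inner ha hρ)
    fun β => (integral_exp_pos (integrable_exp_inner ha hρ β)).ne'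
  refine continuous_integral_of_norm_le_exp ha hρ (fun β => by fun_prop) (fun x => by fun_prop)
    ‖β₀‖ fun β x => ?_
  rw [abs_mul, abs_of_pos (Real.exp_pos _)]
  calc Real.exp (inner ℝ β x) * |inner ℝ (β - β₀) x|
      ≤ Real.exp (‖β‖ * ‖x‖) * ((‖β₀‖ + ‖β‖) * ‖x‖) := by
        gcongr
        · exact real_inner_le_norm β x
        · refine (abs_real_inner_le_norm _ _).trans ?_
          gcongr
          rw [add_comm]; exact norm_sub_le _ _
    _ = (‖β₀‖ + ‖β‖) * (Real.exp (‖β‖ * ‖x‖) * ‖x‖) := by ring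
    _ ≤ _ := by
        gcongr
        nlinarith [sq_nonneg (‖x‖ - 1)]

lemma integrable_sq_norm_tilted (ha : 0 < a)
    (hρ : Integrable (fun x => Real.exp (a * ‖x‖ ^ 2)) ρ) (β : E) :
    Integrable (fun x => ‖x‖ ^ 2) (ρ.tilted (inner ℝ β)) := by
  refine (integrable_tilted_iff (integrable_exp_inner ha hρ β) _).2 ?_
  refine integrable_of_norm_le_exp ha hρ (Continuous.aestronglyMeasurable (by fun_prop)) ‖β‖ 1
    fun x => ?_
  rw [norm_smul, Real.norm_of_nonneg (by positivity), Real.norm_of_nonneg (by positivity), one_mul]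
  gcongr
  · exact real_inner_le_norm β x
  · linarith

/-- The second moment in an exponential family with a sub-Gaussian base measure grows at most
quadratically in the parameter. -/
lemma exists_integral_sq_norm_tilted_le (ha : 0 < a)
    (hρ : Integrable (fun x => Real.exp (a * ‖x‖ ^ 2)) ρ) {β₀ : E}
    (hmin : ∀ β', ∫ x, Real.exp (inner ℝ β₀ x) ∂ρ ≤ ∫ x, Real.exp (inner ℝ β' x) ∂ρ) :
    ∃ C : ℝ, 0 ≤ C ∧ ∀ β : E,
      ∫ x, ‖x‖ ^ 2 ∂(ρ.tilted (inner ℝ β)) ≤ C * (1 + ‖β - β₀‖ ^ 2) := by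
  set I := ∫ x, Real.exp (a * ‖x‖ ^ 2) ∂ρ with hI
  set c := ∫ x, Real.exp (inner ℝ β₀ x) ∂ρ with hc
  have hIpos : 0 < I := integral_exp_pos hρ
  have hcpos : 0 < c := integral_exp_pos (integrable_exp_inner ha hρ β₀)
  have main : ∀ β : E, ∫ x, ‖x‖ ^ 2 ∂(ρ.tilted (inner ℝ β))
      ≤ 2 / a * (‖β‖ ^ 2 / (2 * a) + Real.log (I / c)) := by
    intro β
    set Z := ∫ x, Real.exp (inner ℝ β x) ∂ρ with hZ
    have hZpos : 0 < Z := integral_exp_pos (integrable_exp_inner ha hρ β)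
    have hp := isProbabilityMeasure_tilted (integrable_exp_inner ha hρ β)
    -- `L` bounds the logarithm of the tilted mean of `exp (a / 2 * ‖x‖ ^ 2)`: the other half of `a`
    -- absorbs the tilt, and the normaliser is at least its minimum `c`.
    set L := ‖β‖ ^ 2 / (2 * a) + Real.log (I / c) with hL
    have hpt : ∀ x : E, Real.exp (inner ℝ β x) * Real.exp (a / 2 * ‖x‖ ^ 2)
        ≤ Real.exp (‖β‖ ^ 2 / (2 * a)) * Real.exp (a * ‖x‖ ^ 2) := by
      intro x
      rw [← Real.exp_add, ← Real.exp_add]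
      refine Real.exp_le_exp.2 ?_
      have h1 := real_inner_le_norm β x
      have h2 : ‖β‖ ^ 2 / (2 * a) + a / 2 * ‖x‖ ^ 2 - ‖β‖ * ‖x‖
          = (‖β‖ - a * ‖x‖) ^ 2 / (2 * a) := by field_simp; ring
      have h3 : 0 ≤ (‖β‖ - a * ‖x‖) ^ 2 / (2 * a) := by positivity
      linarith
    have hint1 : Integrable (fun x => Real.exp (inner ℝ β x) * Real.exp (a / 2 * ‖x‖ ^ 2)) ρ := by
      refine (hρ.const_mul (Real.exp (‖β‖ ^ 2 / (2 * a)))).mono'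
        (Continuous.aestronglyMeasurable (by fun_prop)) (ae_of_all _ fun x => ?_)
      rw [Real.norm_of_nonneg (by positivity)]
      exact hpt x
    have hint2 : Integrable (fun x => Real.exp (a / 2 * ‖x‖ ^ 2)) (ρ.tilted (inner ℝ β)) :=
      (integrable_tilted_iff (integrable_exp_inner ha hρ β) _).2 hint1
    have hexp : ∫ x, Real.exp (a / 2 * ‖x‖ ^ 2) ∂(ρ.tilted (inner ℝ β)) ≤ Real.exp L := by
      calc ∫ x, Real.exp (a / 2 * ‖x‖ ^ 2) ∂(ρ.tilted (inner ℝ β))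
          = (∫ x, Real.exp (inner ℝ β x) * Real.exp (a / 2 * ‖x‖ ^ 2) ∂ρ) / Z := by
            rw [integral_exp_tilted]
            congr 2 with x
            rw [Pi.add_apply, Real.exp_add]
        _ ≤ (Real.exp (‖β‖ ^ 2 / (2 * a)) * I) / c := by
            gcongr
            · rw [hI, ← integral_const_mul]
              exact integral_mono hint1 (hρ.const_mul _) hpt
            · exact hmin β
        _ = Real.exp L := by
            rw [hL, Real.exp_add, Real.exp_log (by positivity)]; ring
    -- Jensen's inequality through the tangent line `s ≤ L - 1 + exp (s - L)`.
    have h5 : ∫ x, a / 2 * ‖x‖ ^ 2 ∂(ρ.tilted (inner ℝ β))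
        ≤ ∫ x, (L - 1 + Real.exp (-L) * Real.exp (a / 2 * ‖x‖ ^ 2)) ∂(ρ.tilted (inner ℝ β)) := by
      refine integral_mono ((integrable_sq_norm_tilted ha hρ β).const_mul _)
        ((integrable_const _).add (hint2.const_mul _)) fun x => ?_
      have := Real.add_one_le_exp (-L + a / 2 * ‖x‖ ^ 2)
      simp only [← Real.exp_add]
      linarith
    rw [integral_const_mul, integral_add (integrable_const _) (hint2.const_mul _),
      integral_const_mul, integral_const, probReal_univ, one_smul] at h5
    have h6 : Real.exp (-L) * ∫ x, Real.exp (a / 2 * ‖x‖ ^ 2) ∂(ρ.tilted (inner ℝ β)) ≤ 1 := by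
      calc _ ≤ Real.exp (-L) * Real.exp L := by gcongr
        _ = 1 := by rw [← Real.exp_add]; simp
    have h7 : a / 2 * ∫ x, ‖x‖ ^ 2 ∂(ρ.tilted (inner ℝ β)) ≤ L := by linarith
    calc ∫ x, ‖x‖ ^ 2 ∂(ρ.tilted (inner ℝ β))
        = 2 / a * (a / 2 * ∫ x, ‖x‖ ^ 2 ∂(ρ.tilted (inner ℝ β))) := by field_simp
      _ ≤ 2 / a * L := by gcongr
  set D := |Real.log (I / c)| with hD
  refine ⟨2 / a * ((1 + ‖β₀‖ ^ 2) / a + D), by positivity, fun β => (main β).trans ?_⟩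
  rw [mul_assoc]
  gcongr
  have h1 : ‖β‖ ≤ ‖β - β₀‖ + ‖β₀‖ := by simpa using norm_add_le (β - β₀) β₀
  have h2 : ‖β‖ ^ 2 / (2 * a) ≤ (1 + ‖β₀‖ ^ 2) / a * (1 + ‖β - β₀‖ ^ 2) := by
    have h3 : ‖β‖ ^ 2 ≤ 2 * ((1 + ‖β₀‖ ^ 2) * (1 + ‖β - β₀‖ ^ 2)) := by
      have h4 : ‖β‖ ^ 2 ≤ (‖β - β₀‖ + ‖β₀‖) ^ 2 := by gcongr
      nlinarith [sq_nonneg (‖β - β₀‖ - ‖β₀‖), sq_nonneg (‖β - β₀‖ * ‖β₀‖)]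
    calc ‖β‖ ^ 2 / (2 * a) ≤ 2 * ((1 + ‖β₀‖ ^ 2) * (1 + ‖β - β₀‖ ^ 2)) / (2 * a) := by gcongr
      _ = _ := by field_simp
  have h3 : Real.log (I / c) ≤ D * (1 + ‖β - β₀‖ ^ 2) :=
    (le_abs_self _).trans (le_mul_of_one_le_right (abs_nonneg _) (by nlinarith [sq_nonneg ‖β - β₀‖]))
  linarith

end ExponentialFamily

/-! ### Stochastic approximation: supermartingales and Robbins–Monro. -/

section StochasticApproximation

open scoped ENNReal

variable {Ω : Type*} {m mΩ : MeasurableSpace Ω} {P : Measure Ω} [IsProbabilityMeasure P]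

/-- If `x` has conditional law `κ (b ω)` given `m`, then functions of `(b, x)` are integrated by
first integrating out `x`. -/
lemma setLIntegral_of_condLaw {E F : Type*} [MeasurableSpace E] [MeasurableSpace F]
    (hm : m ≤ mΩ)
    {κ : Kernel E F} [IsMarkovKernel κ] {b : Ω → E} {x : Ω → F} (hb : Measurable[m] b)
    (hx : Measurable x)
    (hlaw : ∀ B : Set F, MeasurableSet B → P⟦x ⁻¹' B | m⟧ =ᵐ[P] fun ω => (κ (b ω)).real B)
    {A : Set Ω} (hA : MeasurableSet[m] A) {g : E × F → ℝ≥0∞} (hg : Measurable g) :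
    ∫⁻ ω in A, g (b ω, x ω) ∂P = ∫⁻ ω in A, ∫⁻ y, g (b ω, y) ∂(κ (b ω)) ∂P := by
  have hb' : Measurable b := hb.mono hm le_rfl
  -- Rectangles suffice, and there `b ⁻¹' s ∩ A` is `m`-measurable, hence a legitimate test set for
  -- the conditional probability.
  have key : (P.restrict A).map (fun ω => (b ω, x ω)) = ((P.restrict A).map b) ⊗ₘ κ := by
    refine Measure.ext_prod fun {s t} hs ht => ?_
    rw [Measure.map_apply (hb'.prodMk hx) (hs.prod ht), Measure.compProd_apply_prod hs ht,
      setLIntegral_map hs (κ.measurable_coe ht) hb', Measure.restrict_restrict (hb' hs)]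
    have hset : MeasurableSet[m] (b ⁻¹' s ∩ A) := (hb hs).inter hA
    have h1 := setIntegral_condExp (μ := P) hm
      (f := (x ⁻¹' t).indicator fun _ => (1 : ℝ))
      ((integrable_const (1 : ℝ)).indicator (hx ht)) hset
    rw [setIntegral_congr_ae (g := fun ω => (κ (b ω)).real t) (hm _ hset)
      ((hlaw t ht).mono fun ω h _ => h), integral_indicator (hx ht)] at h1
    have hmeas : Measurable fun ω => κ (b ω) t := (κ.measurable_coe ht).comp hb'
    simp only [measureReal_def] at h1
    rw [integral_toReal hmeas.aemeasurable (ae_of_all _ fun ω => measure_lt_top _ _)] at h1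
    simp only [integral_const, smul_eq_mul, mul_one, measureReal_def] at h1
    rw [Measure.restrict_apply_univ, Measure.restrict_apply (hx ht)] at h1
    have h2 : (∫⁻ ω in b ⁻¹' s ∩ A, κ (b ω) t ∂P) ≠ ⊤ := by
      refine ne_top_of_le_ne_top ?_ (setLIntegral_mono measurable_const fun ω _ => prob_le_one)
      simp
    rw [(ENNReal.toReal_eq_toReal_iff' h2 (measure_ne_top _ _)).1 h1,
      Measure.restrict_apply ((hb'.prodMk hx) (hs.prod ht))]
    congr 1
    ext ω
    simp only [Set.mem_inter_iff, Set.mem_preimage, Set.mem_prod]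
    tauto
  rw [← lintegral_map (μ := P.restrict A) hg (hb'.prodMk hx), key, Measure.lintegral_compProd hg,
    lintegral_map _ hb']
  exact hg.lintegral_kernel_prod_right'

/-- A version of the Robbins-Siegmund theorem. -/
lemma ae_tendsto_and_summable_of_setLIntegral_le {ℱ : Filtration ℕ mΩ} {W D : ℕ → Ω → ℝ}
    (hW : ∀ i, Measurable[ℱ i] (W i)) (hD : ∀ i, Measurable (D i)) (hW0 : ∀ i ω, 0 ≤ W i ω)
    (hD0 : ∀ i ω, 0 ≤ D i ω) (hfin : ∫⁻ ω, ENNReal.ofReal (W 0 ω) ∂P ≠ ⊤)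
    (hle : ∀ i, ∀ A : Set Ω, MeasurableSet[ℱ i] A →
      ∫⁻ ω in A, ENNReal.ofReal (W (i + 1) ω) ∂P + ∫⁻ ω in A, ENNReal.ofReal (D i ω) ∂P
        ≤ ∫⁻ ω in A, ENNReal.ofReal (W i ω) ∂P) :
    ∀ᵐ ω ∂P, (∃ w, Tendsto (fun i => W i ω) atTop (𝓝 w)) ∧ Summable fun i => D i ω := by
  have hWm : ∀ i, Measurable (W i) := fun i => (hW i).mono (ℱ.le i) le_rfl
  -- Telescoping over the whole space bounds both the mean of every `W n` and the total mean of the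
  -- `D i`.
  have hsum : ∀ n, ∫⁻ ω, ENNReal.ofReal (W n ω) ∂P
      + ∑ i ∈ Finset.range n, ∫⁻ ω, ENNReal.ofReal (D i ω) ∂P
      ≤ ∫⁻ ω, ENNReal.ofReal (W 0 ω) ∂P := by
    intro n
    induction n with
    | zero => simp
    | succ n ih =>
      have := hle n Set.univ MeasurableSet.univ
      simp only [setLIntegral_univ] at this
      refine le_trans ?_ ih
      rw [Finset.sum_range_succ, add_comm (∑ i ∈ Finset.range n, _), ← add_assoc]
      gcongr
  have hWle : ∀ n, ∫⁻ ω, ENNReal.ofReal (W n ω) ∂P ≤ ∫⁻ ω, ENNReal.ofReal (W 0 ω) ∂P :=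
    fun n => le_self_add.trans (hsum n)
  have hint : ∀ n, Integrable (W n) P := fun n =>
    (lintegral_ofReal_ne_top_iff_integrable (hWm n).aestronglyMeasurable
      (ae_of_all _ (hW0 n))).1 (ne_top_of_le_ne_top hfin (hWle n))
  -- An L¹-bounded submartingale converges almost surely.
  have hsub : Submartingale (-W) ℱ P := by
    refine (supermartingale_of_setIntegral_succ_le
      (fun i => (hW i).stronglyMeasurable) hint fun i s hs => ?_).neg
    rw [integral_eq_lintegral_of_nonneg_ae (ae_of_all _ (hW0 _)) (hWm _).aestronglyMeasurable,
      integral_eq_lintegral_of_nonneg_ae (ae_of_all _ (hW0 _)) (hWm _).aestronglyMeasurable]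
    refine ENNReal.toReal_mono ?_ (le_self_add.trans (hle i s hs))
    exact ne_top_of_le_ne_top hfin ((setLIntegral_le_lintegral _ _).trans (hWle i))
  have h1 : ∀ᵐ ω ∂P, ∃ c, Tendsto (fun n => (-W) n ω) atTop (𝓝 c) := by
    refine hsub.exists_ae_tendsto_of_bdd
      (R := (∫⁻ ω, ENNReal.ofReal (W 0 ω) ∂P).toNNReal) fun n => ?_
    rw [ENNReal.coe_toNNReal hfin, eLpNorm_one_eq_lintegral_enorm]
    refine le_trans (le_of_eq (lintegral_congr fun ω => ?_)) (hWle n)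
    simp [Real.enorm_eq_ofReal (hW0 n ω)]
  have h2 : ∀ᵐ ω ∂P, ∑' i, ENNReal.ofReal (D i ω) < ⊤ := by
    refine ae_lt_top (Measurable.tsum fun i => (hD i).ennreal_ofReal) ?_
    rw [lintegral_tsum fun i => (hD i).ennreal_ofReal.aemeasurable]
    refine ne_top_of_le_ne_top hfin ?_
    rw [ENNReal.tsum_eq_iSup_nat]
    exact iSup_le fun n => le_add_self.trans (hsum n)
  filter_upwards [h1, h2] with ω ⟨c, hc⟩ h2
  refine ⟨⟨-c, by simpa using hc.neg⟩, ?_⟩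
  have := ENNReal.summable_toReal h2.ne
  simpa [ENNReal.toReal_ofReal (hD0 _ ω)] using this

/-- The deterministic part of the convergence of the Robbins-Monro iteration. -/
lemma tendsto_of_lyapunov {E : Type*} [NormedAddCommGroup E] [ProperSpace E] {β₀ : E}
    {h : E → ℝ} (hcont : Continuous h) (hpos : ∀ β, β ≠ β₀ → 0 < h β) {b : ℕ → E} {γ : ℕ → ℝ}
    (hγ : ∀ i, 0 ≤ γ i) (hdiv : Tendsto (fun n => ∑ i ∈ Finset.range n, γ i) atTop atTop)
    {v : ℝ} (hv : Tendsto (fun i => ‖b i - β₀‖ ^ 2) atTop (𝓝 v))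
    (hsum : Summable fun i => γ i * h (b i)) : Tendsto b atTop (𝓝 β₀) := by
  have hv0 : 0 ≤ v := ge_of_tendsto' hv fun i => by positivity
  rcases hv0.eq_or_lt with rfl | hvpos
  · rw [tendsto_iff_norm_sub_tendsto_zero]
    have := hv.sqrt
    simpa [Real.sqrt_sq] using this
  exfalso
  -- If `v > 0`, the iterates end up in this compact annulus, where `h` is at least some `ε > 0`.
  -- Summability of `γ i * h (b i)` would then make `γ` summable.
  have hK : IsCompact {β : E | v / 2 ≤ ‖β - β₀‖ ^ 2 ∧ ‖β - β₀‖ ^ 2 ≤ v + 1} := by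
    refine (isCompact_closedBall β₀ (v + 2)).of_isClosed_subset ?_ fun β hβ => ?_
    · have hf : Continuous fun β : E => ‖β - β₀‖ ^ 2 := by fun_prop
      exact (isClosed_le continuous_const hf).inter (isClosed_le hf continuous_const)
    · rw [mem_closedBall_iff_norm]
      have := hβ.2
      nlinarith [norm_nonneg (β - β₀)]
  obtain ⟨ε, hε, hle⟩ := hK.exists_forall_le' hcont.continuousOn (a := 0) fun β hβ => by
    refine hpos β ?_
    rintro rfl
    have := hβ.1
    simp at this
    linarith
  refine (not_summable_iff_tendsto_nat_atTop_of_nonneg hγ).2 hdiv ?_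
  refine (hsum.mul_left ε⁻¹).of_norm_bounded_eventually_nat ?_
  filter_upwards [hv.eventually_const_le (show v / 2 < v by linarith),
    hv.eventually_le_const (show v < v + 1 by linarith)] with i h1 h2
  have h3 := hle (b i) ⟨h1, h2⟩
  rw [Real.norm_of_nonneg (hγ i)]
  calc γ i = ε⁻¹ * (γ i * ε) := by field_simp
    _ ≤ _ := by
      have := hγ i
      gcongr

/-- Almost sure convergence of the Robbins-Monro iteration. -/
theorem ae_tendsto_robbinsMonro {E : Type*} [NormedAddCommGroup E] [InnerProductSpace ℝ E]
    [FiniteDimensional ℝ E] [MeasurableSpace E] [BorelSpace E] {κ : Kernel E E} [IsMarkovKernel κ]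
    {β₀ : E} {C : ℝ} (hC : 0 ≤ C) (hint : ∀ β, Integrable (fun x => ‖x‖ ^ 2) (κ β))
    (hle : ∀ β, ∫ x, ‖x‖ ^ 2 ∂(κ β) ≤ C * (1 + ‖β - β₀‖ ^ 2))
    (hcont : Continuous fun β => ∫ x, inner ℝ (β - β₀) x ∂(κ β))
    (hpos : ∀ β, β ≠ β₀ → 0 < ∫ x, inner ℝ (β - β₀) x ∂(κ β))
    {γ : ℕ → ℝ} (hγ : ∀ i, 0 ≤ γ i)
    (hdiv : Tendsto (fun n => ∑ i ∈ Finset.range n, γ i) atTop atTop)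
    (hsq : Summable fun i => γ i ^ 2) {ℱ : Filtration ℕ mΩ} {b x : ℕ → Ω → E} {b₀ : E}
    (hb0 : ∀ ω, b 0 ω = b₀) (hstep : ∀ i ω, b (i + 1) ω = b i ω - γ i • x i ω)
    (hx : ∀ i, Measurable[ℱ (i + 1)] (x i))
    (hlaw : ∀ i, ∀ B : Set E, MeasurableSet B →
      P⟦x i ⁻¹' B | ℱ i⟧ =ᵐ[P] fun ω => (κ (b i ω)).real B) :
    ∀ᵐ ω ∂P, Tendsto (fun i => b i ω) atTop (𝓝 β₀) := by
  set h : E → ℝ := fun β => ∫ x, inner ℝ (β - β₀) x ∂(κ β) with hh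
  have hh0 : ∀ β, 0 ≤ h β := fun β => by
    rcases eq_or_ne β β₀ with rfl | hne
    · simp [hh]
    · exact (hpos β hne).le
  have hb : ∀ i, Measurable[ℱ i] (b i) := by
    intro i
    induction i with
    | zero =>
      rw [show b 0 = fun _ => b₀ from funext hb0]
      exact measurable_const
    | succ i ih =>
      rw [show b (i + 1) = fun ω => b i ω - γ i • x i ω from funext (hstep i)]
      exact (ih.mono (ℱ.mono i.le_succ) le_rfl).sub ((hx i).const_smul (γ i))
  have hbm : ∀ i, Measurable (b i) := fun i => (hb i).mono (ℱ.le i) le_rfl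
  have hxm : ∀ i, Measurable (x i) := fun i => (hx i).mono (ℱ.le _) le_rfl
  set c : ℕ → ℝ := fun i => C * γ i ^ 2 with hc
  have hc0 : ∀ i, 0 ≤ c i := fun i => by positivity
  -- The drift inequality carries a factor `1 + c i`; dividing by these products removes it. They
  -- stay bounded because the squared steps are summable.
  set a : ℕ → ℝ := fun n => ∏ i ∈ Finset.range n, (1 + c i) with hadef
  have ha1 : ∀ n, 1 ≤ a n := fun n => by
    exact Finset.prod_induction _ (fun t => 1 ≤ t)
      (fun _ _ h1 h2 => one_le_mul_of_one_le_of_one_le h1 h2) le_rfl fun i _ => by linarith [hc0 i]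
  have hapos : ∀ n, 0 < a n := fun n => one_pos.trans_le (ha1 n)
  have hasucc : ∀ n, a (n + 1) = a n * (1 + c n) := fun n => Finset.prod_range_succ _ _
  have hamono : Monotone a := monotone_nat_of_le_succ fun n => by
    rw [hasucc]
    exact le_mul_of_one_le_right (hapos n).le (by linarith [hc0 n])
  have hcs : Summable c := hsq.mul_left C
  have habdd : ∀ n, a n ≤ Real.exp (∑' i, c i) := fun n => by
    calc a n ≤ ∏ i ∈ Finset.range n, Real.exp (c i) := by
          refine Finset.prod_le_prod (fun i _ => by linarith [hc0 i]) fun i _ => ?_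
          linarith [Real.add_one_le_exp (c i)]
      _ = Real.exp (∑ i ∈ Finset.range n, c i) := (Real.exp_sum _ _).symm
      _ ≤ _ := Real.exp_le_exp.2 (hcs.sum_le_tsum _ fun i _ => hc0 i)
  obtain ⟨aInf, haInf⟩ : ∃ t, Tendsto a atTop (𝓝 t) :=
    ⟨_, tendsto_atTop_ciSup hamono ⟨_, by rintro _ ⟨n, rfl⟩; exact habdd n⟩⟩
  have hinner : ∀ β w, Integrable (fun x => inner ℝ w x) (κ β) := fun β w => by
    refine ((integrable_const (1 : ℝ)).add (hint β)).const_mul ‖w‖ |>.mono'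
      (Continuous.aestronglyMeasurable (by fun_prop)) (ae_of_all _ fun x => ?_)
    refine (norm_inner_le_norm w x).trans ?_
    simp only [Pi.add_apply]
    gcongr
    nlinarith [sq_nonneg (‖x‖ - 1)]
  -- One-step drift: in the expanded square the cross term gives `-2 * γ i * h β`, and `hle` absorbs
  -- the quadratic term into the factor `1 + c i`.
  have hmom : ∀ i β, ∫⁻ y, ENNReal.ofReal (1 + ‖β - γ i • y - β₀‖ ^ 2) ∂(κ β)
      + ENNReal.ofReal (2 * γ i * h β) ≤ ENNReal.ofReal ((1 + ‖β - β₀‖ ^ 2) * (1 + c i)) := by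
    intro i β
    have hexp : ∀ y : E, 1 + ‖β - γ i • y - β₀‖ ^ 2
        = (1 + ‖β - β₀‖ ^ 2) - 2 * γ i * inner ℝ (β - β₀) y + γ i ^ 2 * ‖y‖ ^ 2 := by
      intro y
      rw [show β - γ i • y - β₀ = (β - β₀) - γ i • y by abel, norm_sub_sq_real, norm_smul,
        real_inner_smul_right, mul_pow, Real.norm_eq_abs, sq_abs]
      ring
    have hI1 : Integrable (fun y => (1 + ‖β - β₀‖ ^ 2) - 2 * γ i * inner ℝ (β - β₀) y) (κ β) :=
      (integrable_const _).sub ((hinner β _).const_mul _)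
    have hI2 := (hint β).const_mul (γ i ^ 2)
    have hI : Integrable (fun y => 1 + ‖β - γ i • y - β₀‖ ^ 2) (κ β) := by
      simp_rw [hexp]
      exact hI1.add hI2
    rw [← ofReal_integral_eq_lintegral_ofReal hI (ae_of_all _ fun y => by positivity),
      ← ENNReal.ofReal_add (integral_nonneg fun y => by positivity)
        (mul_nonneg (by linarith [hγ i]) (hh0 β))]
    refine ENNReal.ofReal_le_ofReal ?_
    simp_rw [hexp]
    rw [integral_add hI1 hI2, integral_sub (integrable_const _) ((hinner β _).const_mul _),
      integral_const_mul, integral_const_mul, integral_const, probReal_univ, one_smul]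
    have := mul_le_mul_of_nonneg_left (hle β) (sq_nonneg (γ i))
    simp only [hh, hc]
    nlinarith
  have hV : ∀ i, ∀ A : Set Ω, MeasurableSet[ℱ i] A →
      ∫⁻ ω in A, ENNReal.ofReal (1 + ‖b (i + 1) ω - β₀‖ ^ 2) ∂P
        + ∫⁻ ω in A, ENNReal.ofReal (2 * γ i * h (b i ω)) ∂P
        ≤ ∫⁻ ω in A, ENNReal.ofReal ((1 + ‖b i ω - β₀‖ ^ 2) * (1 + c i)) ∂P := by
    intro i A hA
    have h1 := setLIntegral_of_condLaw (ℱ.le i) (hb i) (hxm i) (hlaw i) hA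
      (g := fun p => ENNReal.ofReal (1 + ‖p.1 - γ i • p.2 - β₀‖ ^ 2)) (by fun_prop)
    simp only [← hstep] at h1
    rw [h1, ← lintegral_add_right]
    · exact lintegral_mono fun ω => hmom i (b i ω)
    · exact ((hcont.measurable.comp (hbm i)).const_mul _).ennreal_ofReal
  have hRS := ae_tendsto_and_summable_of_setLIntegral_le (P := P) (ℱ := ℱ)
    (W := fun i ω => (a i)⁻¹ * (1 + ‖b i ω - β₀‖ ^ 2))
    (D := fun i ω => (a (i + 1))⁻¹ * (2 * γ i * h (b i ω)))
    (fun i => (show Measurable fun β : E => (a i)⁻¹ * (1 + ‖β - β₀‖ ^ 2) by fun_prop).comp (hb i))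
    (fun i => ((hcont.measurable.comp (hbm i)).const_mul _).const_mul _)
    (fun i ω => by have := hapos i; positivity)
    (fun i ω => by have := hapos (i + 1); have := hγ i; have := hh0 (b i ω); positivity)
    (by simp [hb0]) (fun i A hA => by
      have hai := hapos i
      have hai1 := hapos (i + 1)
      have e1 : ∀ t, ENNReal.ofReal ((a (i + 1))⁻¹ * t)
          = ENNReal.ofReal (a (i + 1))⁻¹ * ENNReal.ofReal t := fun t =>
        ENNReal.ofReal_mul (by positivity)
      have e2 : ∀ t, ENNReal.ofReal ((a i)⁻¹ * t)
          = ENNReal.ofReal (a (i + 1))⁻¹ * ENNReal.ofReal (t * (1 + c i)) := fun t => by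
        have := hc0 i
        rw [← ENNReal.ofReal_mul (by positivity), hasucc]
        congr 1
        have : 1 + c i ≠ 0 := by positivity
        field_simp
      simp_rw [e1, e2]
      rw [lintegral_const_mul' _ _ ENNReal.ofReal_ne_top,
        lintegral_const_mul' _ _ ENNReal.ofReal_ne_top,
        lintegral_const_mul' _ _ ENNReal.ofReal_ne_top, ← mul_add]
      gcongr
      exact hV i A hA)
  filter_upwards [hRS] with ω ⟨⟨w, hw⟩, hs⟩
  -- Multiplying the discounted process by `a i` recovers `1 + ‖b i ω - β₀‖ ^ 2`, hence the limit
  -- `aInf * w - 1`.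
  refine tendsto_of_lyapunov hcont hpos hγ hdiv (v := aInf * w - 1) ?_ ?_
  · refine ((haInf.mul hw).sub_const 1).congr fun i => ?_
    have := (hapos i).ne'
    field_simp
    ring
  · refine (hs.mul_left (Real.exp (∑' i, c i))).of_nonneg_of_le
      (fun i => mul_nonneg (hγ i) (hh0 _)) fun i => ?_
    have h1 := habdd (i + 1)
    have h2 := hapos (i + 1)
    have h3 : 0 ≤ γ i * h (b i ω) := mul_nonneg (hγ i) (hh0 _)
    have h4 : 1 ≤ Real.exp (∑' i, c i) * (a (i + 1))⁻¹ := by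
      rw [← div_eq_mul_inv, one_le_div h2]; exact h1
    nlinarith

end StochasticApproximation

/-! ### Exponential tilting, images and conditioning. -/

section Tilting

variable {α α' : Type*} [MeasurableSpace α] [MeasurableSpace α'] {μ : Measure α}

lemma tilted_map {φ : α → α'} (hφ : Measurable φ) {g : α' → ℝ} (hg : Measurable g) :
    (μ.map φ).tilted g = (μ.tilted (g ∘ φ)).map φ := by
  ext s hs
  rw [tilted_apply' _ _ hs, Measure.map_apply hφ hs, tilted_apply' _ _ (hφ hs),
    setLIntegral_map hs (by fun_prop) hφ, integral_map hφ.aemeasurable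
      (by fun_prop : Measurable fun x => Real.exp (g x)).aestronglyMeasurable]
  rfl

lemma tilted_add_const [NeZero μ] {f : α → ℝ} (hf : Integrable (fun x => Real.exp (f x)) μ)
    (c : ℝ) : μ.tilted (fun x => f x + c) = μ.tilted f := by
  have := isProbabilityMeasure_tilted hf
  rw [show (fun x => f x + c) = f + fun _ => c from rfl, ← tilted_tilted hf, tilted_const]

/-- Both scalars must be the inverse total mass of `R`, so normalising constants never have to be
matched by hand. -/
lemma eq_of_smul_measure {R Q₁ Q₂ : Measure α} [IsProbabilityMeasure Q₁] [IsProbabilityMeasure Q₂]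
    {k₁ k₂ : ENNReal} (h₁ : Q₁ = k₁ • R) (h₂ : Q₂ = k₂ • R) : Q₁ = Q₂ := by
  have e₁ : k₁ * R Set.univ = 1 := by
    rw [← smul_eq_mul, ← Measure.smul_apply, ← h₁]; exact measure_univ
  have e₂ : k₂ * R Set.univ = 1 := by
    rw [← smul_eq_mul, ← Measure.smul_apply, ← h₂]; exact measure_univ
  rw [h₁, h₂, ENNReal.eq_inv_of_mul_eq_one_left e₁, ENNReal.eq_inv_of_mul_eq_one_left e₂]

lemma tilted_eq_smul_withDensity (f : α → ℝ) :
    μ.tilted f = ENNReal.ofReal (∫ x, Real.exp (f x) ∂μ)⁻¹ •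
      μ.withDensity fun x => ENNReal.ofReal (Real.exp (f x)) := by
  rw [← withDensity_smul' _ _ ENNReal.ofReal_ne_top, Measure.tilted]
  congr with x
  rw [Pi.smul_apply, smul_eq_mul, ← ENNReal.ofReal_mul (by positivity), div_eq_inv_mul]

/-- Conditioning commutes with exponential tilting. -/
lemma cond_tilted [IsProbabilityMeasure μ] {f : α → ℝ}
    (hf : Integrable (fun x => Real.exp (f x)) μ) {K : Set α} (hK : μ K ≠ 0) :
    ProbabilityTheory.cond (μ.tilted f) K = (ProbabilityTheory.cond μ K).tilted f := by
  have hp := isProbabilityMeasure_tilted hf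
  have hK' : μ.tilted f K ≠ 0 := fun h => hK (absolutelyContinuous_tilted hf h)
  have i1 := cond_isProbabilityMeasure hK
  have i2 := cond_isProbabilityMeasure hK'
  have hf' : Integrable (fun x => Real.exp (f x)) (ProbabilityTheory.cond μ K) :=
    hf.restrict.smul_measure (ENNReal.inv_ne_top.2 hK)
  have i3 := isProbabilityMeasure_tilted hf'
  -- Both sides are multiples of `μ` restricted to `K` with density `exp f`. Measurability of `K` is
  -- not needed.
  have e1 : ProbabilityTheory.cond (μ.tilted f) K
      = (((μ.tilted f) K)⁻¹ * ENNReal.ofReal (∫ x, Real.exp (f x) ∂μ)⁻¹) •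
        (μ.restrict K).withDensity fun x => ENNReal.ofReal (Real.exp (f x)) := by
    have h : (μ.tilted f).restrict K = ENNReal.ofReal (∫ x, Real.exp (f x) ∂μ)⁻¹ •
        (μ.restrict K).withDensity fun x => ENNReal.ofReal (Real.exp (f x)) := by
      rw [tilted_eq_smul_withDensity, Measure.restrict_smul, restrict_withDensity']
    rw [ProbabilityTheory.cond, h, smul_smul]
  have e2 : (ProbabilityTheory.cond μ K).tilted f
      = (ENNReal.ofReal (∫ x, Real.exp (f x) ∂(ProbabilityTheory.cond μ K))⁻¹ * (μ K)⁻¹) •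
        (μ.restrict K).withDensity fun x => ENNReal.ofReal (Real.exp (f x)) := by
    rw [tilted_eq_smul_withDensity, ProbabilityTheory.cond, withDensity_smul_measure, smul_smul]
  exact eq_of_smul_measure e1 e2

end Tilting

/-! ### Cameron–Martin for isotropic Gaussian measures. -/

section Gaussian

open scoped RealInnerProductSpace

variable {ι : Type*} [Fintype ι]

/-- Complex coefficients cover the real tilt and the Fourier variable at once. The integral factors
into one-dimensional Gaussian ones. -/
lemma integral_cexp_sum_stdGaussian (z : ι → ℂ) :
    ∫ x, Complex.exp (∑ j, z j * x j) ∂(stdGaussian (EuclideanSpace ℝ ι))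
      = Complex.exp (∑ j, z j ^ 2 / 2) := by
  rw [← map_pi_eq_stdGaussian, integral_map (by fun_prop)
    (Continuous.aestronglyMeasurable (by fun_prop))]
  simp_rw [Complex.exp_sum]
  have h := integral_fintype_prod_eq_prod (μ := fun _ : ι => gaussianReal 0 1)
    (fun j (x : ℝ) => Complex.exp (z j * x))
  rw [h]
  refine Finset.prod_congr rfl fun j _ => ?_
  have := complexMGF_id_gaussianReal (μ := 0) (v := 1) (z j)
  simpa [complexMGF] using this

/-- The Cameron-Martin formula for the standard Gaussian measure. -/
lemma stdGaussian_tilted (c : EuclideanSpace ℝ ι) :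
    (stdGaussian (EuclideanSpace ℝ ι)).tilted (inner ℝ c)
      = (stdGaussian (EuclideanSpace ℝ ι)).map (c + ·) := by
  have : IsProbabilityMeasure ((stdGaussian (EuclideanSpace ℝ ι)).map (c + ·)) :=
    Measure.isProbabilityMeasure_map (by fun_prop)
  refine Measure.ext_of_charFun (funext fun t => ?_)
  have hZ : ((∫ x, Real.exp ⟪c, x⟫ ∂(stdGaussian (EuclideanSpace ℝ ι)) : ℝ) : ℂ)
      = Complex.exp (∑ j, (c j : ℂ) ^ 2 / 2) := by
    rw [← integral_cexp_sum_stdGaussian, ← integral_complex_ofReal]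
    congr with x
    simp [PiLp.inner_apply, mul_comm]
  have hN : ∫ x, (Real.exp ⟪c, x⟫ : ℂ) * Complex.exp (⟪x, t⟫ * Complex.I)
        ∂(stdGaussian (EuclideanSpace ℝ ι))
      = Complex.exp (∑ j, ((c j : ℂ) + t j * Complex.I) ^ 2 / 2) := by
    rw [← integral_cexp_sum_stdGaussian]
    congr with x
    rw [Complex.ofReal_exp, ← Complex.exp_add]
    simp only [PiLp.inner_apply, RCLike.inner_apply, conj_trivial, Complex.ofReal_sum,
      Complex.ofReal_mul, Finset.sum_mul, ← Finset.sum_add_distrib]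
    congr 1
    refine Finset.sum_congr rfl fun j _ => ?_
    ring
  rw [charFun_map_const_add, charFun_stdGaussian, charFun_apply, integral_tilted]
  simp_rw [Complex.real_smul, Complex.ofReal_div, div_mul_eq_mul_div]
  rw [integral_div, hN, hZ, ← Complex.exp_sub, ← Complex.exp_add]
  congr 1
  rw [← Complex.ofReal_pow, EuclideanSpace.real_norm_sq_eq]
  simp only [PiLp.inner_apply, RCLike.inner_apply, conj_trivial, Complex.ofReal_sum,
    Complex.ofReal_mul, Finset.sum_mul, Complex.ofReal_pow]
  rw [← Finset.sum_sub_distrib, neg_div, Finset.sum_div, ← Finset.sum_neg_distrib,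
    ← Finset.sum_add_distrib]
  refine Finset.sum_congr rfl fun j _ => ?_
  linear_combination ((t j : ℂ) ^ 2 / 2) * Complex.I_sq

lemma integrable_exp_inner_gaussian {E : Type*} [NormedAddCommGroup E] [InnerProductSpace ℝ E]
    [FiniteDimensional ℝ E] [MeasurableSpace E] [BorelSpace E] {μ : Measure E} [IsGaussian μ]
    (c : E) : Integrable (fun x => Real.exp (inner ℝ c x)) μ := by
  obtain ⟨a, ha, hint⟩ := IsGaussian.exists_integrable_exp_sq μ
  exact integrable_exp_inner ha hint c

open scoped MatrixOrder in
lemma multivariateGaussian_sq_smul_one [DecidableEq ι] {σ : ℝ} (hσ : 0 ≤ σ)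
    (m : EuclideanSpace ℝ ι) :
    multivariateGaussian m (σ ^ 2 • (1 : Matrix ι ι ℝ))
      = (stdGaussian (EuclideanSpace ℝ ι)).map fun x => m + σ • x := by
  have h : CFC.sqrt (σ ^ 2 • (1 : Matrix ι ι ℝ)) = σ • 1 := by
    refine CFC.sqrt_unique ?_ ?_
    · rw [smul_mul_smul_comm, mul_one, pow_two]
    · rw [Matrix.nonneg_iff_posSemidef]
      exact Matrix.PosSemidef.one.smul hσ
  rw [multivariateGaussian, h]
  congr with x
  simp

lemma multivariateGaussian_eq_map_add [DecidableEq ι] {σ : ℝ} (hσ : 0 ≤ σ)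
    (m : EuclideanSpace ℝ ι) :
    multivariateGaussian m (σ ^ 2 • (1 : Matrix ι ι ℝ))
      = (multivariateGaussian 0 (σ ^ 2 • (1 : Matrix ι ι ℝ))).map (m + ·) := by
  rw [multivariateGaussian_sq_smul_one hσ, multivariateGaussian_sq_smul_one hσ,
    Measure.map_map (by fun_prop) (by fun_prop)]
  congr with x
  simp

lemma multivariateGaussian_map_neg [DecidableEq ι] {σ : ℝ} (hσ : 0 ≤ σ) :
    (multivariateGaussian 0 (σ ^ 2 • (1 : Matrix ι ι ℝ))).map (fun y => -y)
      = multivariateGaussian 0 (σ ^ 2 • (1 : Matrix ι ι ℝ)) := by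
  have h : (stdGaussian (EuclideanSpace ℝ ι)).map (fun y => -y)
      = stdGaussian (EuclideanSpace ℝ ι) := stdGaussian_map (LinearIsometryEquiv.neg ℝ)
  rw [multivariateGaussian_sq_smul_one hσ, Measure.map_map (by fun_prop) (by fun_prop)]
  conv_rhs => rw [← h, Measure.map_map (by fun_prop) (by fun_prop)]
  refine congrArg (Measure.map · _) (funext fun x => ?_)
  simp

/-- The Cameron-Martin formula for isotropic Gaussian measures. -/
lemma multivariateGaussian_eq_tilted [DecidableEq ι] {σ : ℝ} (hσ : 0 < σ)
    (m : EuclideanSpace ℝ ι) :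
    multivariateGaussian m (σ ^ 2 • (1 : Matrix ι ι ℝ))
      = (multivariateGaussian 0 (σ ^ 2 • (1 : Matrix ι ι ℝ))).tilted
        (inner ℝ ((σ ^ 2)⁻¹ • m)) := by
  rw [multivariateGaussian_sq_smul_one hσ.le, multivariateGaussian_sq_smul_one hσ.le,
    tilted_map (by fun_prop) (by fun_prop)]
  have : (inner ℝ ((σ ^ 2)⁻¹ • m) ∘ fun x : EuclideanSpace ℝ ι => 0 + σ • x)
      = inner ℝ (σ⁻¹ • m) := by
    ext x
    simp only [Function.comp_apply, zero_add, real_inner_smul_left, real_inner_smul_right]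
    field_simp
  rw [this, stdGaussian_tilted, Measure.map_map (by fun_prop) (by fun_prop)]
  congr with x
  simp [smul_smul, hσ.ne']

end Gaussian

variable {n p : ℕ}

/-! ### Geometry of the lasso selection event. -/

section Lasso

variable {X : Matrix (Fin n) (Fin p) ℝ} {lam : ℝ} {M : Finset (Fin p)}

/-- Extension of a vector indexed by `M` by zero. -/
def extendZero (M : Finset (Fin p)) (v : EuclideanSpace ℝ M) : EuclideanSpace ℝ (Fin p) :=
  WithLp.toLp 2 fun j => if h : j ∈ M then v ⟨j, h⟩ else 0

lemma extendZero_of_mem (v : EuclideanSpace ℝ M) (j : M) : extendZero M v j = v j := by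
  simp [extendZero]

lemma extendZero_of_notMem (v : EuclideanSpace ℝ M) {j : Fin p} (hj : j ∉ M) :
    extendZero M v j = 0 := by
  simp [extendZero, hj]

lemma toEuclideanLin_extendZero (v : EuclideanSpace ℝ M) :
    Matrix.toEuclideanLin X (extendZero M v) = Matrix.toEuclideanLin (activeCols X M) v := by
  ext i
  simp only [Matrix.toLpLin_apply, Matrix.mulVec, dotProduct, activeCols, Matrix.submatrix_apply,
    id_eq]
  rw [← Finset.sum_subset M.subset_univ fun j _ hj => by
    rw [extendZero_of_notMem v hj, mul_zero], ← Finset.sum_coe_sort]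
  exact Finset.sum_congr rfl fun j _ => by rw [extendZero_of_mem]

lemma lassoObjective_add_sub (y : EuclideanSpace ℝ (Fin n)) (b d : EuclideanSpace ℝ (Fin p)) :
    lassoObjective X lam y (b + d) - lassoObjective X lam y b
      = 1 / 2 * ‖Matrix.toEuclideanLin X d‖ ^ 2
        - inner ℝ (y - Matrix.toEuclideanLin X b) (Matrix.toEuclideanLin X d)
        + lam * ∑ j, (|b j + d j| - |b j|) := by
  have h : y - Matrix.toEuclideanLin X (b + d)
      = (y - Matrix.toEuclideanLin X b) - Matrix.toEuclideanLin X d := by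
    rw [map_add]; abel
  rw [lassoObjective, lassoObjective, h, norm_sub_sq_real, Finset.sum_sub_distrib]
  simp only [PiLp.add_apply]
  ring

/-- Convexity along a ray: a strict increase at a small step forces one at the full step. -/
lemma lassoObjective_add_smul_sub_le (hlam : 0 ≤ lam) (y : EuclideanSpace ℝ (Fin n))
    (b d : EuclideanSpace ℝ (Fin p)) {t : ℝ} (ht0 : 0 ≤ t) (ht1 : t ≤ 1) :
    lassoObjective X lam y (b + t • d) - lassoObjective X lam y b
      ≤ t * (lassoObjective X lam y (b + d) - lassoObjective X lam y b) := by
  rw [lassoObjective_add_sub, lassoObjective_add_sub, map_smul, norm_smul, real_inner_smul_right,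
    Real.norm_of_nonneg ht0]
  have h1 : ∑ j, (|b j + (t • d) j| - |b j|) ≤ t * ∑ j, (|b j + d j| - |b j|) := by
    rw [Finset.mul_sum]
    refine Finset.sum_le_sum fun j _ => ?_
    have : b j + (t • d) j = (1 - t) * b j + t * (b j + d j) := by
      simp only [PiLp.smul_apply, smul_eq_mul]; ring
    rw [this]
    have h2 := abs_add_le ((1 - t) * b j) (t * (b j + d j))
    rw [abs_mul, abs_mul, abs_of_nonneg ht0, abs_of_nonneg (sub_nonneg.2 ht1)] at h2
    linarith
  have h3 := mul_le_mul_of_nonneg_left h1 hlam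
  have h4 : 0 ≤ t * (1 - t) * ‖Matrix.toEuclideanLin X d‖ ^ 2 := by
    have := sub_nonneg.2 ht1
    positivity
  nlinarith

/-- With such a step no nonzero coefficient changes sign, so on the support the penalty is linear
along `± t • d`. -/
lemma exists_small_scaling (b d : EuclideanSpace ℝ (Fin p)) :
    ∃ t : ℝ, 0 < t ∧ t ≤ 1 ∧ ∀ j, b j ≠ 0 → t * |d j| ≤ |b j| := by
  have h : ∀ j, ∀ᶠ t : ℝ in 𝓝[>] 0, b j ≠ 0 → t * |d j| ≤ |b j| := by
    intro j
    by_cases hj : b j = 0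
    · simp [hj]
    have hc : Tendsto (fun t : ℝ => t * |d j|) (𝓝[>] 0) (𝓝 0) := by
      have : Continuous fun t : ℝ => t * |d j| := by fun_prop
      simpa using (this.tendsto 0).mono_left nhdsWithin_le_nhds
    filter_upwards [hc.eventually_lt_const (abs_pos.2 hj)] with t ht _ using ht.le
  have h1 : ∀ᶠ t : ℝ in 𝓝[>] 0, t ∈ Set.Ioc (0 : ℝ) 1 := Ioc_mem_nhdsGT one_pos
  obtain ⟨t, ht, ht'⟩ := (h1.and (eventually_all.2 h)).exists
  exact ⟨t, ht.1, ht.2, ht'⟩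

lemma intUnit_cases (u : ℤˣ) : ((u : ℤ) : ℝ) = 1 ∨ ((u : ℤ) : ℝ) = -1 := by
  rcases Int.units_eq_one_or u with rfl | rfl <;> simp

lemma abs_add_eq_of_sign {u β δ : ℝ} (hu : u = 1 ∨ u = -1) (hβ : 0 < u * β) (h : |δ| ≤ |β|) :
    |β + δ| = |β| + u * δ := by
  have h' := abs_le.1 h
  rcases hu with rfl | rfl
  · rw [abs_of_pos (by linarith : 0 < β)] at *
    rw [abs_of_nonneg (by linarith)]; ring
  · rw [abs_of_neg (by linarith : β < 0)] at *
    rw [abs_of_nonpos (by linarith)]; ring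

lemma sign_add_le_abs_add {u β δ : ℝ} (hu : u = 1 ∨ u = -1) (hβ : 0 < u * β) :
    |β| + u * δ ≤ |β + δ| := by
  rcases hu with rfl | rfl
  · rw [abs_of_pos (by linarith : 0 < β)]
    linarith [le_abs_self (β + δ)]
  · rw [abs_of_neg (by linarith : β < 0)]
    linarith [neg_le_abs (β + δ)]

/-- Moving the response along the active columns, in a direction that agrees with the signs of the
active coefficients, changes neither the active set nor the signs. -/
lemma signedSelectionEvent_add (hlam : 0 ≤ lam) {s : M → ℤˣ} {y : EuclideanSpace ℝ (Fin n)}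
    (hy : y ∈ signedSelectionEvent X lam M s) {v : EuclideanSpace ℝ M}
    (hv : ∀ j, 0 ≤ ((s j : ℤ) : ℝ) * v j) :
    Matrix.toEuclideanLin (activeCols X M) v + y ∈ signedSelectionEvent X lam M s := by
  obtain ⟨b, hb, hsupp, hsign⟩ := hy
  have hsign' : ∀ j : M, 0 < ((s j : ℤ) : ℝ) * (b + extendZero M v) j := fun j => by
    rw [PiLp.add_apply, extendZero_of_mem, mul_add]
    linarith [hsign j, hv j]
  refine ⟨b + extendZero M v, fun b' hb' => ?_, fun j => ?_, hsign'⟩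
  · obtain ⟨d, rfl⟩ : ∃ d, b' = b + extendZero M v + d := ⟨b' - (b + extendZero M v), by abel⟩
    have hd : d ≠ 0 := by rintro rfl; simp at hb'
    obtain ⟨t, ht0, ht1, ht⟩ := exists_small_scaling b d
    have h1 := lassoObjective_add_smul_sub_le (X := X) hlam
      (Matrix.toEuclideanLin (activeCols X M) v + y) (b + extendZero M v) d ht0.le ht1
    have h2 := hb (b + t • d) (by simp [hd, ht0.ne'])
    -- The residual is the same at both base points, so only penalties differ. On `M` the increment
    -- at `b` is exactly linear with slope `s j`, which is a subgradient bound at the shifted point;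
    -- off `M` the coordinates agree.
    have h3 : lassoObjective X lam y (b + t • d) - lassoObjective X lam y b
        ≤ lassoObjective X lam (Matrix.toEuclideanLin (activeCols X M) v + y)
            (b + extendZero M v + t • d)
          - lassoObjective X lam (Matrix.toEuclideanLin (activeCols X M) v + y)
            (b + extendZero M v) := by
      rw [lassoObjective_add_sub, lassoObjective_add_sub, map_add, toEuclideanLin_extendZero]
      have hres : Matrix.toEuclideanLin (activeCols X M) v + y
          - (Matrix.toEuclideanLin X b + Matrix.toEuclideanLin (activeCols X M) v)
          = y - Matrix.toEuclideanLin X b := by abel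
      rw [hres]
      refine add_le_add_right (mul_le_mul_of_nonneg_left
        (Finset.sum_le_sum fun j _ => ?_) hlam) _
      by_cases hj : j ∈ M
      · have hbj : |(t • d) j| ≤ |b j| := by
          rw [PiLp.smul_apply, smul_eq_mul, abs_mul, abs_of_pos ht0]
          exact ht j ((hsupp j).1 hj)
        have := abs_add_eq_of_sign (intUnit_cases (s ⟨j, hj⟩)) (hsign ⟨j, hj⟩) hbj
        have := sign_add_le_abs_add (δ := (t • d) j) (intUnit_cases (s ⟨j, hj⟩)) (hsign' ⟨j, hj⟩)
        linarith
      · rw [PiLp.add_apply, extendZero_of_notMem v hj, add_zero]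
    have h4 : 0 < t * (lassoObjective X lam (Matrix.toEuclideanLin (activeCols X M) v + y)
            (b + extendZero M v + d)
          - lassoObjective X lam (Matrix.toEuclideanLin (activeCols X M) v + y)
            (b + extendZero M v)) := by linarith
    linarith [(mul_pos_iff_of_pos_left ht0).1 h4]
  · by_cases hj : j ∈ M
    · have := hsign' ⟨j, hj⟩
      simp only [hj, true_iff]
      intro h0
      simp [h0] at this
    · have h0 : b j = 0 := by
        by_contra h
        exact hj ((hsupp j).2 h)
      simp [hj, extendZero_of_notMem v hj, h0]

lemma lassoObjective_neg (y : EuclideanSpace ℝ (Fin n)) (b : EuclideanSpace ℝ (Fin p)) :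
    lassoObjective X lam (-y) (-b) = lassoObjective X lam y b := by
  have h : -y - Matrix.toEuclideanLin X (-b) = -(y - Matrix.toEuclideanLin X b) := by
    rw [map_neg]; abel
  simp only [lassoObjective, h, norm_neg, PiLp.neg_apply, abs_neg]

lemma signedSelectionEvent_neg {s : M → ℤˣ} {y : EuclideanSpace ℝ (Fin n)}
    (hy : y ∈ signedSelectionEvent X lam M s) : -y ∈ signedSelectionEvent X lam M (-s) := by
  obtain ⟨b, hb, hsupp, hsign⟩ := hy
  refine ⟨-b, fun b' hb' => ?_, fun j => ?_, fun j => ?_⟩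
  · rw [lassoObjective_neg, ← neg_neg b', lassoObjective_neg]
    exact hb _ fun h => hb' (by rw [← h, neg_neg])
  · simp [hsupp j]
  · simpa using hsign j

lemma signedSelectionEvent_subset (s : M → ℤˣ) :
    signedSelectionEvent X lam M s ⊆ selectionEvent X lam M :=
  fun _ ⟨b, hb, hsupp, _⟩ => ⟨b, hb, hsupp⟩

lemma selectionEvent_subset_iUnion :
    selectionEvent X lam M ⊆ ⋃ s, signedSelectionEvent X lam M s := by
  rintro y ⟨b, hb, hsupp⟩
  refine Set.mem_iUnion.2 ⟨fun j => if 0 < b j then 1 else -1, b, hb, hsupp, fun j => ?_⟩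
  have hj : b j ≠ 0 := (hsupp j).1 j.2
  by_cases h : 0 < b j
  · simp [h]
  · simpa [h] using lt_of_le_of_ne (not_lt.1 h) hj

/-- Uniqueness of the lasso estimate forces the active columns to be linearly independent. -/
lemma eq_zero_of_activeCols_eq_zero {y : EuclideanSpace ℝ (Fin n)}
    (hy : y ∈ selectionEvent X lam M) {v : EuclideanSpace ℝ M}
    (hv : Matrix.toEuclideanLin (activeCols X M) v = 0) : v = 0 := by
  obtain ⟨b, hb, hsupp⟩ := hy
  by_contra hne
  have hd : extendZero M v ≠ 0 := by
    intro h
    refine hne (PiLp.ext fun j => ?_)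
    rw [← extendZero_of_mem, h]; rfl
  set d := extendZero M v with hd'
  have hXd : Matrix.toEuclideanLin X d = 0 := by rw [toEuclideanLin_extendZero, hv]
  obtain ⟨t, ht0, -, ht⟩ := exists_small_scaling b d
  have h1 := hb (b + t • d) (by simp [hd, ht0.ne'])
  have h2 := hb (b + (-t) • d) (by simp [hd, ht0.ne'])
  have e1 := lassoObjective_add_sub (X := X) (lam := lam) y b (t • d)
  have e2 := lassoObjective_add_sub (X := X) (lam := lam) y b ((-t) • d)
  rw [map_smul, hXd] at e1 e2
  -- The fit does not move along `d` and the penalty is linear there, so the two increments cancel,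
  -- whereas strict minimality makes both positive.
  have e3 : ∑ j, (|b j + (t • d) j| - |b j|) + ∑ j, (|b j + ((-t) • d) j| - |b j|) = 0 := by
    rw [← Finset.sum_add_distrib]
    refine Finset.sum_eq_zero fun j _ => ?_
    simp only [PiLp.smul_apply, smul_eq_mul, neg_mul]
    by_cases hj : j ∈ M
    · have hbj := (hsupp j).1 hj
      have hle : |t * d j| ≤ |b j| := by
        rw [abs_mul, abs_of_pos ht0]; exact ht j hbj
      obtain ⟨u, hu, hub⟩ : ∃ u : ℝ, (u = 1 ∨ u = -1) ∧ 0 < u * b j := by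
        rcases lt_or_gt_of_ne hbj with h | h
        · exact ⟨-1, Or.inr rfl, by linarith⟩
        · exact ⟨1, Or.inl rfl, by linarith⟩
      rw [abs_add_eq_of_sign hu hub hle, abs_add_eq_of_sign hu hub (by rwa [abs_neg])]
      ring
    · simp [hd', extendZero_of_notMem v hj]
  simp only [smul_zero, norm_zero, inner_zero_right] at e1 e2
  have e4 := congrArg (lam * ·) e3
  simp only [mul_add, mul_zero] at e4
  linarith

lemma isUnit_det_gram {y : EuclideanSpace ℝ (Fin n)} (hy : y ∈ selectionEvent X lam M) :
    IsUnit (gram X M).det := by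
  rw [isUnit_iff_ne_zero]
  intro h
  obtain ⟨v, hv, hv0⟩ := Matrix.exists_mulVec_eq_zero_iff.2 h
  have h1 : (activeCols X M).mulVec v = 0 := by
    rw [← Matrix.conjTranspose_mul_self_mulVec_eq_zero, Matrix.conjTranspose_eq_transpose_of_trivial]
    exact hv0
  refine hv ?_
  have := eq_zero_of_activeCols_eq_zero hy (v := WithLp.toLp 2 v) (by
    rw [Matrix.toLpLin_apply]; simp [h1])
  simpa using this

/-- Lets laws of `η` be rewritten as laws of X_Mᵀz; the point `y` only certifies that the Gram
matrix is invertible. -/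
lemma gram_leastSquares {y : EuclideanSpace ℝ (Fin n)} (hy : y ∈ selectionEvent X lam M)
    (z : EuclideanSpace ℝ (Fin n)) :
    Matrix.toEuclideanLin (gram X M) (leastSquares X M z) = suffStat X M z := by
  rw [leastSquares, Matrix.toLpLin_apply, Matrix.toLpLin_apply]
  simp [Matrix.mulVec_mulVec, Matrix.mul_nonsing_inv _ (isUnit_det_gram hy)]

lemma inner_suffStat (β : EuclideanSpace ℝ M) (z : EuclideanSpace ℝ (Fin n)) :
    inner ℝ β (suffStat X M z) = inner ℝ (Matrix.toEuclideanLin (activeCols X M) β) z := by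
  rw [suffStat, ← Matrix.conjTranspose_eq_transpose_of_trivial,
    Matrix.toEuclideanLin_conjTranspose_eq_adjoint, LinearMap.adjoint_inner_right]

lemma suffStat_add (z z' : EuclideanSpace ℝ (Fin n)) :
    suffStat X M (z + z') = suffStat X M z + suffStat X M z' := map_add _ _ _

end Lasso

/-! ### Selection probability bounded below, and the uniform variance bound. -/

section ResponseLaw

variable {X : Matrix (Fin n) (Fin p) ℝ} {lam : ℝ} {M : Finset (Fin p)} {σ : ℝ}

instance isGaussian_responseLaw (β : EuclideanSpace ℝ M) : IsGaussian (responseLaw X M σ β) := by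
  unfold responseLaw; infer_instance

lemma responseLaw_eq_map (hσ : 0 ≤ σ) (β : EuclideanSpace ℝ M) :
    responseLaw X M σ β
      = (responseLaw X M σ 0).map (Matrix.toEuclideanLin (activeCols X M) β + ·) := by
  rw [responseLaw, responseLaw, map_zero, multivariateGaussian_eq_map_add hσ]

lemma responseLaw_zero_map_neg (hσ : 0 ≤ σ) :
    (responseLaw X M σ 0).map (fun y => -y) = responseLaw X M σ 0 := by
  rw [responseLaw, map_zero, multivariateGaussian_map_neg hσ]

lemma responseLaw_eq_tilted (hσ : 0 < σ) (β : EuclideanSpace ℝ M) :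
    responseLaw X M σ β
      = (responseLaw X M σ 0).tilted fun z => inner ℝ β ((σ ^ 2)⁻¹ • suffStat X M z) := by
  rw [responseLaw, responseLaw, map_zero, multivariateGaussian_eq_tilted hσ]
  congr with z
  rw [real_inner_smul_left, real_inner_smul_right, inner_suffStat]

lemma continuous_suffStat : Continuous (suffStat X M) :=
  (Matrix.toEuclideanLin (activeCols X M).transpose).continuous_of_finiteDimensional

lemma continuous_leastSquares : Continuous (leastSquares X M) :=
  (Matrix.toEuclideanLin (gram X M)⁻¹).continuous_of_finiteDimensional.comp continuous_suffStat

lemma integrable_exp_inner_suffStat (β : EuclideanSpace ℝ M) :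
    Integrable (fun z => Real.exp (inner ℝ β ((σ ^ 2)⁻¹ • suffStat X M z)))
      (responseLaw X M σ 0) := by
  refine (integrable_exp_inner_gaussian
    ((σ ^ 2)⁻¹ • Matrix.toEuclideanLin (activeCols X M) β)).congr (ae_of_all _ fun z => ?_)
  simp only [real_inner_smul_left, real_inner_smul_right, inner_suffStat]

lemma responseLaw_absolutelyContinuous (hσ : 0 < σ) (β : EuclideanSpace ℝ M) :
    responseLaw X M σ β ≪ responseLaw X M σ 0 := by
  rw [responseLaw_eq_tilted hσ]
  exact tilted_absolutelyContinuous _ _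

lemma integrable_condResponseLaw {F : Type*} [NormedAddCommGroup F]
    {f : EuclideanSpace ℝ (Fin n) → F} {β : EuclideanSpace ℝ M}
    (hf : Integrable f (responseLaw X M σ β))
    (hM : responseLaw X M σ β (selectionEvent X lam M) ≠ 0) :
    Integrable f (condResponseLaw X lam M σ β) :=
  hf.restrict.smul_measure (ENNReal.inv_ne_top.2 hM)

lemma isProbabilityMeasure_condResponseLaw {β : EuclideanSpace ℝ M}
    (hM : responseLaw X M σ β (selectionEvent X lam M) ≠ 0) :
    IsProbabilityMeasure (condResponseLaw X lam M σ β) :=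
  cond_isProbabilityMeasure hM

lemma integrable_suffStat (β : EuclideanSpace ℝ M) :
    Integrable (suffStat X M) (responseLaw X M σ β) :=
  (Matrix.toEuclideanLin (activeCols X M).transpose).toContinuousLinearMap.integrable_comp
    (IsGaussian.integrable_id (μ := responseLaw X M σ β))

lemma integrable_sq_norm_suffStat_sub (β c : EuclideanSpace ℝ M) :
    Integrable (fun z => ‖suffStat X M z - c‖ ^ 2) (responseLaw X M σ β) := by
  have h : MemLp (fun z => suffStat X M z - c) 2 (responseLaw X M σ β) :=
    ((Matrix.toEuclideanLin (activeCols X M).transpose).toContinuousLinearMap.comp_memLp'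
      (IsGaussian.memLp_two_id (μ := responseLaw X M σ β))).sub (memLp_const c)
  exact h.integrable_norm_pow two_ne_zero

/-- P_β is P_0 translated by X_M β, and this translation maps the signed event into itself.
`Measure.le_map_apply` spares proving that the event is measurable. -/
lemma responseLaw_signedSelectionEvent_mono (hlam : 0 ≤ lam) (hσ : 0 ≤ σ) {s : M → ℤˣ}
    {β : EuclideanSpace ℝ M} (hβ : ∀ j, 0 ≤ ((s j : ℤ) : ℝ) * β j) :
    responseLaw X M σ 0 (signedSelectionEvent X lam M s)
      ≤ responseLaw X M σ β (signedSelectionEvent X lam M s) := by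
  rw [responseLaw_eq_map hσ β]
  refine le_trans (measure_mono fun y hy => ?_) (Measure.le_map_apply (by fun_prop) _)
  exact signedSelectionEvent_add hlam hy hβ

/-- If all sign patterns have positive probability, the selection probability is bounded away
from zero. -/
lemma exists_le_responseLaw_selectionEvent (hlam : 0 ≤ lam) (hσ : 0 ≤ σ)
    (h : ∀ s : M → ℤˣ, 0 < responseLaw X M σ 0 (signedSelectionEvent X lam M s)) :
    ∃ c : ENNReal, 0 < c ∧ ∀ β : EuclideanSpace ℝ M,
      c ≤ responseLaw X M σ β (selectionEvent X lam M) := by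
  obtain ⟨s₀, hs₀⟩ := Finite.exists_min
    fun s : M → ℤˣ => responseLaw X M σ 0 (signedSelectionEvent X lam M s)
  -- The pattern used for `β` is that of its own signs, with zero counted as positive.
  refine ⟨_, h s₀, fun β => (hs₀ fun j => if 0 ≤ β j then 1 else -1).trans
    ((responseLaw_signedSelectionEvent_mono hlam hσ fun j => ?_).trans
      (measure_mono (signedSelectionEvent_subset _)))⟩
  by_cases hj : 0 ≤ β j
  · simp [hj]
  · simpa [hj] using (not_le.1 hj).le

lemma integral_sq_norm_sub_integral_le {α F : Type*} [MeasurableSpace α] {Q : Measure α}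
    [IsProbabilityMeasure Q] [NormedAddCommGroup F] [InnerProductSpace ℝ F] [CompleteSpace F]
    {f : α → F} (hf : Integrable f Q) (hf2 : ∀ c, Integrable (fun z => ‖f z - c‖ ^ 2) Q) (c : F) :
    ∫ z, ‖f z - ∫ z, f z ∂Q‖ ^ 2 ∂Q ≤ ∫ z, ‖f z - c‖ ^ 2 ∂Q := by
  set m := ∫ z, f z ∂Q with hm
  have h : ∀ z, ‖f z - c‖ ^ 2
      = ‖f z - m‖ ^ 2 + (2 * inner ℝ (m - c) (f z - m) + ‖m - c‖ ^ 2) := fun z => by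
    rw [show f z - c = (f z - m) + (m - c) by abel, norm_add_sq_real, real_inner_comm]; ring
  have hfm : Integrable (fun z => f z - m) Q := hf.sub (integrable_const m)
  have hI : Integrable (fun z => inner ℝ (m - c) (f z - m)) Q := hfm.const_inner (𝕜 := ℝ) _
  have hI' : Integrable (fun z => 2 * inner ℝ (m - c) (f z - m) + ‖m - c‖ ^ 2) Q :=
    (hI.const_mul 2).add (integrable_const _)
  have h0 : ∫ z, inner ℝ (m - c) (f z - m) ∂Q = 0 := by
    rw [integral_inner hfm, integral_sub hf (integrable_const m)]
    simp [hm]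
  simp_rw [h]
  rw [integral_add (hf2 m) hI',
    integral_add (hI.const_mul 2) (integrable_const _), integral_const_mul, h0]
  simp

/-- The conditional mean minimises mean square deviation, so the unconditional mean `m` may replace
it. Dropping the conditioning costs `c.toReal⁻¹`, and translation moves the remaining moment to P_0.
-/
lemma integral_sq_norm_condResponseLaw_le (hσ : 0 ≤ σ) {c : ENNReal} (hc : 0 < c)
    {β : EuclideanSpace ℝ M} (hle : c ≤ responseLaw X M σ β (selectionEvent X lam M)) :
    ∫ z, ‖suffStat X M z - ∫ z, suffStat X M z ∂(condResponseLaw X lam M σ β)‖ ^ 2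
        ∂(condResponseLaw X lam M σ β)
      ≤ c.toReal⁻¹ * ∫ z, ‖suffStat X M z‖ ^ 2 ∂(responseLaw X M σ 0) := by
  have hK : responseLaw X M σ β (selectionEvent X lam M) ≠ 0 := (hc.trans_le hle).ne'
  have := isProbabilityMeasure_condResponseLaw hK
  set m := suffStat X M (Matrix.toEuclideanLin (activeCols X M) β) with hm
  have hc' : c ≠ ⊤ := ne_top_of_le_ne_top (measure_ne_top _ _) hle
  calc _ ≤ ∫ z, ‖suffStat X M z - m‖ ^ 2 ∂(condResponseLaw X lam M σ β) :=
        integral_sq_norm_sub_integral_le (integrable_condResponseLaw (integrable_suffStat β) hK)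
          (fun c => integrable_condResponseLaw (integrable_sq_norm_suffStat_sub β c) hK) m
    _ = (responseLaw X M σ β (selectionEvent X lam M)).toReal⁻¹ *
        ∫ z in selectionEvent X lam M, ‖suffStat X M z - m‖ ^ 2 ∂(responseLaw X M σ β) := by
        rw [condResponseLaw, ProbabilityTheory.cond, integral_smul_measure, ENNReal.toReal_inv,
          smul_eq_mul]
    _ ≤ c.toReal⁻¹ * ∫ z, ‖suffStat X M z - m‖ ^ 2 ∂(responseLaw X M σ β) := by
        refine mul_le_mul ?_ ?_ (integral_nonneg fun z => by positivity) (by positivity)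
        · exact inv_anti₀ (ENNReal.toReal_pos hc.ne' hc')
            (ENNReal.toReal_mono (measure_ne_top _ _) hle)
        · exact setIntegral_le_integral (integrable_sq_norm_suffStat_sub β m)
            (ae_of_all _ fun z => by positivity)
    _ = _ := by
        have hcont : Continuous fun z => ‖suffStat X M z - m‖ ^ 2 :=
          (continuous_suffStat.sub continuous_const).norm.pow 2
        rw [responseLaw_eq_map hσ β, integral_map (by fun_prop) hcont.aestronglyMeasurable]
        simp only [suffStat_add, hm, add_sub_cancel_left]

/-- The conditional variance of the sufficient statistic is bounded uniformly in the parameter. -/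
theorem exists_variance_bound (hlam : 0 ≤ lam) (hσ : 0 < σ)
    (hs : ∀ s : M → ℤˣ, 0 < responseLaw X M σ 0 (signedSelectionEvent X lam M s)) :
    ∃ A : ℝ, ∀ β : EuclideanSpace ℝ M,
      Integrable (fun z => z) (condResponseLaw X lam M σ β) ∧
      Integrable (fun η => ‖Matrix.toEuclideanLin (gram X M) η
        - suffStat X M (∫ z, z ∂(condResponseLaw X lam M σ β))‖ ^ 2)
        (postSelectionLaw X lam M σ β) ∧
      ∫ η, ‖Matrix.toEuclideanLin (gram X M) η
        - suffStat X M (∫ z, z ∂(condResponseLaw X lam M σ β))‖ ^ 2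
        ∂(postSelectionLaw X lam M σ β) ≤ A := by
  obtain ⟨c, hc, hle⟩ := exists_le_responseLaw_selectionEvent hlam hσ.le hs
  refine ⟨c.toReal⁻¹ * ∫ z, ‖suffStat X M z‖ ^ 2 ∂(responseLaw X M σ 0), fun β => ?_⟩
  have hK : responseLaw X M σ β (selectionEvent X lam M) ≠ 0 := (hc.trans_le (hle β)).ne'
  obtain ⟨y, hy⟩ := nonempty_of_measure_ne_zero hK
  have hid : Integrable (fun z => z) (condResponseLaw X lam M σ β) :=
    integrable_condResponseLaw IsGaussian.integrable_fun_id hK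
  have hmean : suffStat X M (∫ z, z ∂(condResponseLaw X lam M σ β))
      = ∫ z, suffStat X M z ∂(condResponseLaw X lam M σ β) :=
    ((Matrix.toEuclideanLin
      (activeCols X M).transpose).toContinuousLinearMap.integral_comp_comm hid).symm
  have hG : Continuous (Matrix.toEuclideanLin (gram X M)) :=
    LinearMap.continuous_of_finiteDimensional _
  have hmeas : AEStronglyMeasurable (fun η => ‖Matrix.toEuclideanLin (gram X M) η
      - suffStat X M (∫ z, z ∂(condResponseLaw X lam M σ β))‖ ^ 2)
      ((condResponseLaw X lam M σ β).map (leastSquares X M)) :=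
    Continuous.aestronglyMeasurable (by fun_prop)
  have hLS : AEMeasurable (leastSquares X M) (condResponseLaw X lam M σ β) :=
    continuous_leastSquares.measurable.aemeasurable
  refine ⟨hid, ?_, ?_⟩
  · rw [postSelectionLaw, integrable_map_measure hmeas hLS]
    simp only [Function.comp_def, gram_leastSquares hy]
    exact integrable_condResponseLaw (integrable_sq_norm_suffStat_sub β _) hK
  · rw [postSelectionLaw, integral_map hLS hmeas]
    simp only [gram_leastSquares hy, hmean]
    exact integral_sq_norm_condResponseLaw_le hσ.le hc (hle β)

end ResponseLaw

/-! ### The conditional exponential family and convergence of the ascent. -/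

section Ascent

variable {X : Matrix (Fin n) (Fin p) ℝ} {lam : ℝ} {M : Finset (Fin p)} {σ : ℝ}

lemma exists_signedSelectionEvent_pos {μ : Measure (EuclideanSpace ℝ (Fin n))}
    (h : μ (selectionEvent X lam M) ≠ 0) : ∃ s, μ (signedSelectionEvent X lam M s) ≠ 0 := by
  by_contra! h0
  exact h (measure_mono_null selectionEvent_subset_iUnion (measure_iUnion_null h0))

lemma responseLaw_signedSelectionEvent_neg (hσ : 0 ≤ σ) {s : M → ℤˣ}
    (h : responseLaw X M σ 0 (signedSelectionEvent X lam M s) ≠ 0) :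
    responseLaw X M σ 0 (signedSelectionEvent X lam M (-s)) ≠ 0 := by
  have hsub : signedSelectionEvent X lam M s
      ⊆ (fun y => -y) ⁻¹' signedSelectionEvent X lam M (-s) := by
    intro y hy
    rw [Set.mem_preimage]
    exact signedSelectionEvent_neg hy
  refine ((pos_iff_ne_zero.2 h).trans_le ?_).ne'
  calc responseLaw X M σ 0 (signedSelectionEvent X lam M s)
      ≤ responseLaw X M σ 0 ((fun y => -y) ⁻¹' signedSelectionEvent X lam M (-s)) :=
        measure_mono hsub
    _ ≤ (responseLaw X M σ 0).map (fun y => -y) (signedSelectionEvent X lam M (-s)) :=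
        Measure.le_map_apply (by fun_prop) _
    _ = _ := by rw [responseLaw_zero_map_neg hσ]

/-- The sufficient statistic is unbounded in every direction on the selection event. -/
lemma responseLaw_inter_selectionEvent_pos (hlam : 0 ≤ lam) (hσ : 0 < σ)
    (hK : responseLaw X M σ 0 (selectionEvent X lam M) ≠ 0) {u : EuclideanSpace ℝ M}
    (hu : u ≠ 0) (c : ℝ) :
    responseLaw X M σ 0 ({z | c < inner ℝ u (suffStat X M z)} ∩ selectionEvent X lam M) ≠ 0 := by
  obtain ⟨y, hy⟩ := nonempty_of_measure_ne_zero hK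
  set w := suffStat X M (Matrix.toEuclideanLin (activeCols X M) u) with hw
  have hw0 : w ≠ 0 := by
    intro h
    have h1 := inner_suffStat (X := X) u (Matrix.toEuclideanLin (activeCols X M) u)
    rw [← hw, h, inner_zero_right] at h1
    exact hu (eq_zero_of_activeCols_eq_zero hy (inner_self_eq_zero.1 h1.symm))
  obtain ⟨j, hj⟩ : ∃ j, w j ≠ 0 := by
    by_contra! h
    exact hw0 (PiLp.ext h)
  -- P_0 is symmetric, so a pattern with the wrong sign at `j` may be replaced by its negative.
  obtain ⟨s, hs, hsj⟩ : ∃ s : M → ℤˣ, responseLaw X M σ 0 (signedSelectionEvent X lam M s) ≠ 0 ∧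
      0 < ((s j : ℤ) : ℝ) * w j := by
    obtain ⟨s, hs⟩ := exists_signedSelectionEvent_pos hK
    have hne : ((s j : ℤ) : ℝ) * w j ≠ 0 := mul_ne_zero (by simp) hj
    rcases lt_or_gt_of_ne hne with h | h
    · exact ⟨-s, responseLaw_signedSelectionEvent_neg hσ.le hs, by simpa using h⟩
    · exact ⟨s, hs, h⟩
  set g := ((s j : ℤ) : ℝ) * w j with hg
  -- As `R` grows these sets exhaust the signed event, so one of them is not null.
  obtain ⟨R, hR⟩ : ∃ R : ℕ, responseLaw X M σ 0
      ({z | c - R * g < inner ℝ u (suffStat X M z)} ∩ signedSelectionEvent X lam M s) ≠ 0 := by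
    by_contra! h0
    refine hs (measure_mono_null (fun z hz => Set.mem_iUnion.2 ?_) (measure_iUnion_null h0))
    obtain ⟨R, hR⟩ := exists_nat_gt ((c - inner ℝ u (suffStat X M z)) / g)
    refine ⟨R, ?_, hz⟩
    rw [div_lt_iff₀ hsj] at hR
    simp only [Set.mem_ofPred_eq]
    linarith
  -- Translation by X_M v raises `⟨u, suffStat X M z⟩` by exactly `R * g` and preserves the signed
  -- event.
  set v : EuclideanSpace ℝ M := EuclideanSpace.single j (R * ((s j : ℤ) : ℝ)) with hv
  have hsub : {z | c - R * g < inner ℝ u (suffStat X M z)} ∩ signedSelectionEvent X lam M s ⊆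
      (Matrix.toEuclideanLin (activeCols X M) v + ·) ⁻¹'
        ({z | c < inner ℝ u (suffStat X M z)} ∩ selectionEvent X lam M) := by
    rintro z ⟨hz, hzs⟩
    refine ⟨?_, signedSelectionEvent_subset s (signedSelectionEvent_add hlam hzs fun k => ?_)⟩
    · have h1 : inner ℝ u (suffStat X M (Matrix.toEuclideanLin (activeCols X M) v)) = R * g := by
        rw [inner_suffStat, real_inner_comm, ← inner_suffStat, ← hw, hv,
          EuclideanSpace.inner_single_left, hg]
        simp
        ring
      simp only [Set.mem_ofPred_eq] at hz ⊢
      rw [suffStat_add, inner_add_right, h1]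
      linarith
    · by_cases hk : k = j
      · subst hk
        rcases intUnit_cases (s k) with h | h <;> simp [hv, h]
      · simp [hv, hk]
  -- A P_0-null target would also be null under the translate P_v, and so its preimage would be
  -- P_0-null.
  intro h0
  have h1 := responseLaw_absolutelyContinuous hσ v h0
  rw [responseLaw_eq_map hσ.le v] at h1
  exact hR (measure_mono_null hsub
    (le_antisymm ((Measure.le_map_apply (by fun_prop) _).trans h1.le) zero_le))

/-- The centred and rescaled sufficient statistic. -/
def scaledStat (X : Matrix (Fin n) (Fin p) ℝ) (M : Finset (Fin p)) (σ : ℝ) (t : EuclideanSpace ℝ M)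
    (z : EuclideanSpace ℝ (Fin n)) : EuclideanSpace ℝ M :=
  (σ ^ 2)⁻¹ • (suffStat X M z - t)

lemma continuous_scaledStat (t : EuclideanSpace ℝ M) : Continuous (scaledStat X M σ t) :=
  (continuous_suffStat.sub (continuous_const (y := t))).const_smul ((σ ^ 2)⁻¹)

/-- The post-selection laws of the scaled statistic form an exponential family. -/
lemma condResponseLaw_map_scaledStat (hσ : 0 < σ)
    (hK : responseLaw X M σ 0 (selectionEvent X lam M) ≠ 0) (t β : EuclideanSpace ℝ M) :
    (condResponseLaw X lam M σ β).map (scaledStat X M σ t)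
      = ((condResponseLaw X lam M σ 0).map (scaledStat X M σ t)).tilted (inner ℝ β) := by
  have := isProbabilityMeasure_condResponseLaw hK
  have hint := integrable_exp_inner_suffStat (X := X) (M := M) (σ := σ) β
  rw [tilted_map (continuous_scaledStat t).measurable (by fun_prop), condResponseLaw,
    responseLaw_eq_tilted hσ, cond_tilted hint hK, ← condResponseLaw,
    -- Centring at `t` changes the exponent by a constant, which normalisation removes.
    ← tilted_add_const (integrable_condResponseLaw hint hK) (-inner ℝ β ((σ ^ 2)⁻¹ • t))]
  congr with z
  rw [Function.comp_apply, scaledStat, smul_sub, inner_sub_right, sub_eq_add_neg]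

/-- Before conditioning the statistic is Gaussian, so Fernique's theorem applies; conditioning on a
non-null event preserves integrability. -/
lemma exists_integrable_exp_sq_scaledStat
    (hK : responseLaw X M σ 0 (selectionEvent X lam M) ≠ 0) (t : EuclideanSpace ℝ M) :
    ∃ a > 0, Integrable (fun x => Real.exp (a * ‖x‖ ^ 2))
      ((condResponseLaw X lam M σ 0).map (scaledStat X M σ t)) := by
  have hG : IsGaussian ((responseLaw X M σ 0).map (scaledStat X M σ t)) := by
    have e : scaledStat X M σ t = (fun x => x - (σ ^ 2)⁻¹ • t) ∘
        ((σ ^ 2)⁻¹ • Matrix.toEuclideanLin (activeCols X M).transpose).toContinuousLinearMap := by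
      ext1 z
      simp [scaledStat, suffStat, smul_sub]
    rw [e, ← Measure.map_map (by fun_prop) (by fun_prop)]
    infer_instance
  obtain ⟨a, ha, hint⟩ :=
    IsGaussian.exists_integrable_exp_sq ((responseLaw X M σ 0).map (scaledStat X M σ t))
  have hφ := (continuous_scaledStat (X := X) (M := M) (σ := σ) t).measurable
  have hm : Continuous fun x : EuclideanSpace ℝ M => Real.exp (a * ‖x‖ ^ 2) := by fun_prop
  refine ⟨a, ha, (integrable_map_measure hm.aestronglyMeasurable hφ.aemeasurable).2 ?_⟩
  exact integrable_condResponseLaw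
    ((integrable_map_measure hm.aestronglyMeasurable hφ.aemeasurable).1 hint) hK

/-- The statistic exceeds every threshold in direction `u`, in particular `⟨u, t⟩`, so any centre
`t` is allowed. -/
lemma scaledStat_halfSpace_pos (hlam : 0 ≤ lam) (hσ : 0 < σ)
    (hK : responseLaw X M σ 0 (selectionEvent X lam M) ≠ 0) (t : EuclideanSpace ℝ M)
    {u : EuclideanSpace ℝ M} (hu : u ≠ 0) :
    0 < (condResponseLaw X lam M σ 0).map (scaledStat X M σ t) {x | 0 < inner ℝ u x} := by
  have hφ := (continuous_scaledStat (X := X) (M := M) (σ := σ) t).measurable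
  have hset : MeasurableSet {x : EuclideanSpace ℝ M | 0 < inner ℝ u x} :=
    measurableSet_lt measurable_const (by fun_prop)
  rw [Measure.map_apply hφ hset, condResponseLaw, ProbabilityTheory.cond, Measure.smul_apply,
    Measure.restrict_apply (hφ hset), smul_eq_mul]
  refine ENNReal.mul_pos (ENNReal.inv_ne_zero.2 (measure_ne_top _ _)) ?_
  convert responseLaw_inter_selectionEvent_pos hlam hσ hK hu (inner ℝ u t) using 3
  ext z
  simp only [Set.mem_preimage, Set.mem_ofPred_eq, scaledStat, real_inner_smul_right,
    inner_sub_right]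
  rw [mul_pos_iff_of_pos_left (by positivity), sub_pos]

/-- The kernel sending a parameter to the corresponding member of an exponential family. -/
def tiltedKernel {E : Type*} [NormedAddCommGroup E] [InnerProductSpace ℝ E] [FiniteDimensional ℝ E]
    [MeasurableSpace E] [BorelSpace E] (ρ : Measure E) [SFinite ρ] : Kernel E E where
  toFun β := ρ.tilted (inner ℝ β)
  measurable' := by
    refine Measure.measurable_of_measurable_coe _ fun s hs => ?_
    simp_rw [tilted_apply' _ _ hs]
    have h1 : Continuous fun q : E × E => Real.exp (inner ℝ q.1 q.2) := by fun_prop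
    have h2 : Measurable fun β : E => ∫ x, Real.exp (inner ℝ β x) ∂ρ :=
      (h1.stronglyMeasurable.integral_prod_right').measurable
    exact ((h1.measurable.div (h2.comp measurable_fst)).ennreal_ofReal).lintegral_prod_right'

/-- The stochastic ascent iterates converge almost surely to a zero of the score. -/
theorem ae_tendsto_stochasticAscent (hlam : 0 ≤ lam) (hσ : 0 < σ)
    (hM : ∀ β : EuclideanSpace ℝ M, 0 < responseLaw X M σ β (selectionEvent X lam M))
    (y : EuclideanSpace ℝ (Fin n)) {γ : ℕ → ℝ} (hγ : ∀ i, 0 ≤ γ (i + 1))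
    (hdiv : Tendsto (fun N => ∑ i ∈ Finset.range N, γ (i + 1)) atTop atTop)
    (hsq : Summable fun i => γ (i + 1) ^ 2) {Ω : Type*} {mΩ : MeasurableSpace Ω} {P : Measure Ω}
    [IsProbabilityMeasure P] {ℱ : Filtration ℕ mΩ} {b₀ : EuclideanSpace ℝ M}
    {b η : ℕ → Ω → EuclideanSpace ℝ M}
    (h : IsStochasticAscent P ℱ X lam M σ y γ b₀ b η) :
    ∀ᵐ ω ∂P, ∃ bInf : EuclideanSpace ℝ M,
      Tendsto (fun i => b i ω) atTop (𝓝 bInf) ∧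
      Integrable (suffStat X M) (condResponseLaw X lam M σ bInf) ∧
      score X lam M σ y bInf = 0 := by
  have hK := (hM 0).ne'
  obtain ⟨y₀, hy₀⟩ := nonempty_of_measure_ne_zero hK
  have := isProbabilityMeasure_condResponseLaw hK
  set t := suffStat X M y with ht
  set φ := scaledStat X M σ t with hφdef
  have hφ : Measurable φ := (continuous_scaledStat t).measurable
  set ρ := (condResponseLaw X lam M σ 0).map φ with hρdef
  have hρprob : IsProbabilityMeasure ρ := Measure.isProbabilityMeasure_map hφ.aemeasurable
  obtain ⟨a, ha, hρ⟩ := exists_integrable_exp_sq_scaledStat hK t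
  have hs : ∀ u : EuclideanSpace ℝ M, u ≠ 0 → 0 < ρ {x | 0 < inner ℝ u x} :=
    fun u hu => scaledStat_halfSpace_pos hlam hσ hK t hu
  have hmap : ∀ β, (condResponseLaw X lam M σ β).map φ = ρ.tilted (inner ℝ β) :=
    condResponseLaw_map_scaledStat hσ hK t
  obtain ⟨β₀, hmin, hzero⟩ := exists_tilted_mean_zero ha hρ hs
  obtain ⟨C, hC, hmom⟩ := exists_integral_sq_norm_tilted_le ha hρ hmin
  have hMarkov : IsMarkovKernel (tiltedKernel ρ) :=
    ⟨fun β => isProbabilityMeasure_tilted (integrable_exp_inner ha hρ β)⟩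
  set ψ : EuclideanSpace ℝ M → EuclideanSpace ℝ M :=
    fun e => (σ ^ 2)⁻¹ • (Matrix.toEuclideanLin (gram X M) e - t) with hψdef
  have hψ : Measurable ψ := by
    have : Continuous (Matrix.toEuclideanLin (gram X M)) :=
      LinearMap.continuous_of_finiteDimensional _
    exact ((this.sub (continuous_const (y := t))).const_smul ((σ ^ 2)⁻¹)).measurable
  -- The ascent is a descent with samples `ψ (η (i + 1))`, distributed as the tilt of `ρ` at `b i`.
  -- The step `σ ^ 2 * γ (i + 1)` compensates the factor `(σ ^ 2)⁻¹` in `ψ`.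
  have hlim : ∀ᵐ ω ∂P, Tendsto (fun i => b i ω) atTop (𝓝 β₀) := by
    refine ae_tendsto_robbinsMonro (κ := tiltedKernel ρ) (γ := fun i => σ ^ 2 * γ (i + 1))
      (x := fun i ω => ψ (η (i + 1) ω)) hC (integrable_sq_norm_tilted ha hρ) hmom
      (continuous_integral_inner_sub_tilted ha hρ β₀)
      (fun β hne => integral_inner_sub_tilted_pos ha hρ hs hzero hne)
      (fun i => mul_nonneg (by positivity) (hγ i)) ?_ ?_ h.init (fun i ω => ?_)
      (fun i => hψ.comp (h.measurable_sample i)) fun i B hB => ?_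
    · simp_rw [← Finset.mul_sum]
      exact hdiv.const_mul_atTop (by positivity)
    · simp_rw [mul_pow]
      exact hsq.mul_left _
    · rw [h.step, hψdef, smul_smul, mul_right_comm, mul_inv_cancel₀ (by positivity), one_mul,
        sub_eq_add_neg (b i ω), ← smul_neg, neg_sub]
    · refine (h.sample_law i (ψ ⁻¹' B) (hψ hB)).trans (ae_of_all _ fun ω => ?_)
      have e : ψ ∘ leastSquares X M = φ := by
        ext1 z
        simp only [Function.comp_apply, hψdef, gram_leastSquares hy₀, hφdef, scaledStat]
      change (postSelectionLaw X lam M σ (b i ω)).real (ψ ⁻¹' B)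
        = (ρ.tilted (inner ℝ (b i ω))).real B
      rw [← hmap, ← e, ← Measure.map_map hψ continuous_leastSquares.measurable,
        map_measureReal_apply hψ hB, postSelectionLaw]
  have hcond := isProbabilityMeasure_condResponseLaw (hM β₀).ne'
  have hint : Integrable (suffStat X M) (condResponseLaw X lam M σ β₀) :=
    integrable_condResponseLaw (integrable_suffStat β₀) (hM β₀).ne'
  -- Tested against each `w`, the vanishing mean of the tilt at `β₀` is the score equation up to the
  -- factor −σ⁻².
  have hscore : score X lam M σ y β₀ = 0 := by
    refine ext_inner_left ℝ fun w => ?_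
    have h0 := hzero w
    rw [← hmap, integral_map hφ.aemeasurable (Continuous.aestronglyMeasurable (by fun_prop))] at h0
    simp only [hφdef, scaledStat, real_inner_smul_right] at h0
    rw [integral_const_mul, integral_inner (f := fun z => suffStat X M z - t)
      (hint.sub (integrable_const t)), integral_sub hint (integrable_const t)] at h0
    have h1 := (mul_eq_zero.1 h0).resolve_left (by positivity)
    rw [score, ← ht, inner_zero_right, ← neg_sub, inner_neg_right, neg_eq_zero]
    simpa using h1
  filter_upwards [hlim] with ω hω
  exact ⟨β₀, hω, hint, hscore⟩

end Ascent

end PostSelLasso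

end

open PostSelLasso in
theorem mainTheorem4 {n p : ℕ} (X : Matrix (Fin n) (Fin p) ℝ) (lam : ℝ) (hlam : 0 ≤ lam)
    (σ : ℝ) (hσ : 0 < σ) (M : Finset (Fin p))
    (hM : ∀ β : EuclideanSpace ℝ M, 0 < responseLaw X M σ β (selectionEvent X lam M)) :
    ((∀ (s : M → ℤˣ) (β : EuclideanSpace ℝ M),
        0 < responseLaw X M σ β (signedSelectionEvent X lam M s)) →
      ∃ A : ℝ, ∀ β : EuclideanSpace ℝ M,
        Integrable (fun z => z) (condResponseLaw X lam M σ β) ∧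
        Integrable (fun η => ‖Matrix.toEuclideanLin (gram X M) η
          - suffStat X M (∫ z, z ∂(condResponseLaw X lam M σ β))‖ ^ 2)
          (postSelectionLaw X lam M σ β) ∧
        ∫ η, ‖Matrix.toEuclideanLin (gram X M) η
          - suffStat X M (∫ z, z ∂(condResponseLaw X lam M σ β))‖ ^ 2
          ∂(postSelectionLaw X lam M σ β) ≤ A) ∧
    (∀ y ∈ selectionEvent X lam M,
      ∀ γ : ℕ → ℝ, (∀ i, 0 ≤ γ (i + 1)) →
      Tendsto (fun N => ∑ i ∈ Finset.range N, γ (i + 1)) atTop atTop →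
      Summable (fun i => γ (i + 1) ^ 2) →
      ∀ (Ω : Type*) (mΩ : MeasurableSpace Ω) (P : Measure Ω) (_ : IsProbabilityMeasure P)
        (ℱ : Filtration ℕ mΩ) (b₀ : EuclideanSpace ℝ M) (b η : ℕ → Ω → EuclideanSpace ℝ M),
      IsStochasticAscent P ℱ X lam M σ y γ b₀ b η →
      ∀ᵐ ω ∂P, ∃ bInf : EuclideanSpace ℝ M,
        Tendsto (fun i => b i ω) atTop (𝓝 bInf) ∧
        Integrable (suffStat X M) (condResponseLaw X lam M σ bInf) ∧
        score X lam M σ y bInf = 0) := by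
  refine ⟨fun hs => exists_variance_bound hlam hσ fun s => hs s 0, ?_⟩
  intro y _ γ hγ hdiv hsq Ω mΩ P hP ℱ b₀ b η h
  exact ae_tendsto_stochasticAscent hlam hσ hM y hγ hdiv hsq h
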